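/- All simplicial complexes are finite and contain the empty simplex; the non-empty simplices are called faces, and complexes are considered up to renaming of vertices. For a face $\sigma$ of $K$ let $\partial\sigma=\{\tau\mid\tau\subsetneq\sigma\}$, $\mathrm{st}_K(\sigma)=\{\tau\in K\mid \tau\cup\sigma\in K\}$ and $\mathrm{lk}_K(\sigma)=\{\tau\in K\mid \tau\cup\sigma\in K,\ \sigma\cap\tau=\varnothing\}$; for complexes $K,L$ on disjoint vertex sets let $K*L=\{\sigma\cup\tau\mid\sigma\in K,\tau\in L\}$. - The *stellar subdivision* of $K$ at a face $\sigma$ is $\mathrm{ss}_\sigma(K)=(K\setminus\mathrm{st}_K(\sigma))\cup v_\sigma*\partial\sigma*\mathrm{lk}_K(\sigma)$, where $v_\sigma$ is a new vertex. - The *wedge* of $K$ at a vertex $v$ is $\mathrm{wed}_v(K)=I*\mathrm{lk}_K(v)\cup\partial I*\{\sigma\in K\mid v\notin\sigma\}$, where $I$ is the $1$-simplex with vertices $v$ and a new vertex $v'$. The *suspension* of $K$ is $\partial I*K$, where both vertices of $I$ are new. - $K$ is a *PL sphere* if some subdivision of $K$ is also (up to isomorphism) a subdivision of the boundary complex of a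 simplex; the boundary complex $\{\varnothing\}$ of a point is included. A *seed* is a PL sphere that is not the wedge of any PL sphere at one of its vertices. A PL sphere is *suspended* if it is the suspension of a PL sphere, and *non-suspended* otherwise (so the complex $\partial I$ of two points is suspended). - For a complex $K$ with vertex set $[m]=\{1,\dots,m\}$ and a tuple $J=(j_1,\dots,j_m)$ of positive integers, $K(J)$ is the complex obtained from $K$ by a sequence of wedge operations in which each vertex $v$ gets $j_v$ copies $v=v^{(0)},v'=v^{(1)},\dots,v^{(j_v-1)}$. Equivalently, the minimal non-faces of $K(J)$ are those of $K$ with every vertex replaced by all its copies. - For integers $0\le s_v\le j_v-1$ $(v\in[m])$, the *assembled face* of $K(J)$ by $(s_1,\dots,s_m)$ is the set $\{v^{(s_v)}\mid v\in[m],\ j_v\neq 1\}$. **Theorem.** Let $K$ be a seed with vertex set $[m]$, let $J=(j_1,\dots,j_m)$ be a tuple of positive integers with $j_v\le 2$ for all $v\in[m]$, and let $\sigma$ be the assembled face of $K(J)$ by a tuple $(s_1,\dots,s_m)$ with $0\le s_v\le j_v-1$. 1. If $\sigma=\{v^{(s_v)}\}$ for a vertex $v$ of $K$ (in particular, if $\sigma=\{v\}$),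 then $\mathrm{ss}_{\{v,v'\}}(K(J))$ is a suspended seed. 2. If $|\sigma|>1$ and $K$ is non-suspended, then $\mathrm{ss}_\sigma(K(J))$ is a non-suspended seed. -/

import Mathlib

/-!
Finite simplicial complexes are modelled by Mathlib's `PreAbstractSimplicialComplex`, whose
members are the *nonempty* simplices; the empty simplex belongs to every complex implicitly.
In particular the complex `{∅}` (the sphere of dimension `-1`) is the one without members.
An `AbstractSimplicialComplex (Fin m)` is a complex whose vertices are exactly the elements of
`Fin m`; for a complex on a general type `V`, the vertices are the `v : V` with `{v} ∈ K`, and `V`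
is only a supply of names.
-/

namespace PreAbstractSimplicialComplex

/-- `s` is a simplex of `K`, possibly the empty one. -/
def IsSimplex {V : Type*} (K : PreAbstractSimplicialComplex V) (s : Finset V) : Prop :=
  s = ∅ ∨ s ∈ K

theorem IsSimplex.mono {V : Type*} {K : PreAbstractSimplicialComplex V} {s t : Finset V}
    (hs : K.IsSimplex s) (h : t ⊆ s) : K.IsSimplex t := by
  rcases t.eq_empty_or_nonempty with ht | ht
  · exact Or.inl ht
  · rcases hs with rfl | hs
    · exact Or.inl (Finset.subset_empty.mp h)
    · exact Or.inr ((K.isRelLowerSet_faces hs).2 h ht)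

/-- The full simplex on the vertex set `σ`. -/
def simplex {V : Type*} (σ : Finset V) : PreAbstractSimplicialComplex V where
  faces := {τ | τ.Nonempty ∧ τ ⊆ σ}
  isRelLowerSet_faces := fun {_} h => ⟨h.1, fun _ hts ht => ⟨ht, hts.trans h.2⟩⟩

/-- The boundary complex `∂σ` of the simplex `σ`: all proper subsets of `σ`. -/
def boundary {V : Type*} (σ : Finset V) : PreAbstractSimplicialComplex V where
  faces := {τ | τ.Nonempty ∧ τ ⊂ σ}
  isRelLowerSet_faces := fun {_} h => ⟨h.1, fun _ hts ht => ⟨ht, lt_of_le_of_lt hts h.2⟩⟩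

section Operations

variable {V : Type*} [DecidableEq V]

/-- The star of `σ` in `K`: all `τ ∈ K` with `τ ∪ σ ∈ K`. -/
def star (K : PreAbstractSimplicialComplex V) (σ : Finset V) : PreAbstractSimplicialComplex V where
  faces := {τ | τ ∈ K ∧ τ ∪ σ ∈ K}
  isRelLowerSet_faces := fun {_} h => ⟨(K.isRelLowerSet_faces h.1).1, fun _ hts ht =>
    ⟨(K.isRelLowerSet_faces h.1).2 hts ht, (K.isRelLowerSet_faces h.2).2
      (Finset.union_subset_union_left hts) (ht.mono Finset.subset_union_left)⟩⟩

/-- The link of `σ` in `K`: all `τ ∈ K` with `τ ∪ σ ∈ K` and `σ ∩ τ = ∅`. -/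
def link (K : PreAbstractSimplicialComplex V) (σ : Finset V) : PreAbstractSimplicialComplex V where
  faces := {τ | τ ∈ K ∧ τ ∪ σ ∈ K ∧ σ ∩ τ = ∅}
  isRelLowerSet_faces := fun {_} h => ⟨(K.isRelLowerSet_faces h.1).1, fun _ hts ht =>
    ⟨(K.isRelLowerSet_faces h.1).2 hts ht, (K.isRelLowerSet_faces h.2.1).2
      (Finset.union_subset_union_left hts) (ht.mono Finset.subset_union_left),
      Finset.subset_empty.mp (h.2.2 ▸ Finset.inter_subset_inter_left hts)⟩⟩

/-- The deletion of the vertex `v`: all `σ ∈ K` with `v ∉ σ`. -/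
def deletion (K : PreAbstractSimplicialComplex V) (v : V) : PreAbstractSimplicialComplex V where
  faces := {σ | σ ∈ K ∧ v ∉ σ}
  isRelLowerSet_faces := fun {_} h => ⟨(K.isRelLowerSet_faces h.1).1, fun _ hts ht =>
    ⟨(K.isRelLowerSet_faces h.1).2 hts ht, fun hv => h.2 (hts hv)⟩⟩

/-- The join `K ∗ L`: all (nonempty) unions of a possibly empty simplex of `K` and a possibly empty
simplex of `L`. It is used for complexes with disjoint vertex sets. -/
def join (K L : PreAbstractSimplicialComplex V) : PreAbstractSimplicialComplex V where
  faces := {s | s.Nonempty ∧ ∃ σ τ, K.IsSimplex σ ∧ L.IsSimplex τ ∧ s = σ ∪ τ}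
  isRelLowerSet_faces := by
    rintro s ⟨hs, σ, τ, hσ, hτ, rfl⟩
    refine ⟨hs, fun t hts ht => ⟨ht, t ∩ σ, t ∩ τ, hσ.mono Finset.inter_subset_right,
      hτ.mono Finset.inter_subset_right, ?_⟩⟩
    rw [← Finset.inter_union_distrib_left]
    exact (Finset.inter_eq_left.mpr hts).symm

/-- The stellar subdivision `ss_σ(K) = (K ∖ st_K(σ)) ∪ w ∗ ∂σ ∗ lk_K(σ)` of `K` at the face `σ`,
with new vertex `w` (a name that is not used by a vertex of `K`). -/
def stellar (K : PreAbstractSimplicialComplex V) (σ : Finset V) (w : V) :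
    PreAbstractSimplicialComplex V where
  faces := {τ | τ ∈ K ∧ τ ∉ K.star σ} ∪
    ((simplex {w}).join ((boundary σ).join (K.link σ))).faces
  isRelLowerSet_faces := by
    rintro τ (⟨hτ, hst⟩ | h)
    · refine ⟨(K.isRelLowerSet_faces hτ).1, fun ρ hρτ hρ => ?_⟩
      have hρK : ρ ∈ K := (K.isRelLowerSet_faces hτ).2 hρτ hρ
      by_cases hρs : ρ ∈ K.star σ
      · right
        have hns : ¬ σ ⊆ ρ := fun hσ => hst ⟨hτ, by
          rwa [Finset.union_eq_left.mpr (hσ.trans hρτ)]⟩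
        have hsplit : ρ = (ρ ∩ σ) ∪ (ρ \ σ) := by
          ext x; by_cases hx : x ∈ σ <;> simp [hx]
        have h1 : (boundary σ).IsSimplex (ρ ∩ σ) := by
          rcases (ρ ∩ σ).eq_empty_or_nonempty with h | h
          · exact Or.inl h
          · exact Or.inr ⟨h, Finset.inter_subset_right, fun hh =>
              hns (hh.trans Finset.inter_subset_left)⟩
        have h2 : (K.link σ).IsSimplex (ρ \ σ) := by
          rcases (ρ \ σ).eq_empty_or_nonempty with h | h
          · exact Or.inl h
          · refine Or.inr ⟨(K.isRelLowerSet_faces hρK).2 Finset.sdiff_subset h, ?_, by simp⟩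
            rw [Finset.sdiff_union_self_eq_union]
            exact hρs.2
        exact ⟨hρ, ∅, ρ, Or.inl rfl, Or.inr ⟨hρ, _, _, h1, h2, hsplit⟩, by simp⟩
      · exact Or.inl ⟨hρK, hρs⟩
    · have h' := PreAbstractSimplicialComplex.isRelLowerSet_faces _ h
      exact ⟨h'.1, fun ρ hρ hn => Or.inr (h'.2 hρ hn)⟩

/-- The wedge `wed_v(K) = I ∗ lk_K(v) ∪ ∂I ∗ {σ ∈ K | v ∉ σ}` of `K` at the vertex `v`, where `I` is
the 1-simplex `{v, v'}` and `v'` is a name that is not used by a vertex of `K`. -/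
def wedge (K : PreAbstractSimplicialComplex V) (v v' : V) : PreAbstractSimplicialComplex V :=
  (simplex {v, v'}).join (K.link {v}) ⊔ (boundary {v, v'}).join (K.deletion v)

/-- The suspension `∂I ∗ K`, where `I` is the 1-simplex `{a, b}` on two new vertices. -/
def suspension (K : PreAbstractSimplicialComplex V) (a b : V) : PreAbstractSimplicialComplex V :=
  (boundary {a, b}).join K

end Operations

/-- The geometric realization `|K|`: all families of barycentric coordinates (nonnegative, with
sum `1`) whose support is a simplex of `K`. -/
def realization {V : Type*} (K : PreAbstractSimplicialComplex V) : Set (V →₀ ℝ) :=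
  {x | (∀ v, 0 ≤ x v) ∧ (x.sum fun _ c => c) = 1 ∧ x.support ∈ K}

/-- `M` is (isomorphic to) a subdivision of `K`: the vertices `w` of `M` can be placed at points
`p w` of `|K|` in such a way that every simplex of `M` is placed inside a simplex of `K`, and the map
`|M| → |K|` that is linear on every simplex of `M` and sends each vertex `w` to `p w` is a bijection.
(Thus the images of the simplices of `M` are geometric simplices that intersect along common faces
and fill `|K|`.) -/
def IsSubdivision {W V : Type*} (M : PreAbstractSimplicialComplex W)
    (K : PreAbstractSimplicialComplex V) : Prop :=
  ∃ p : W → (V →₀ ℝ),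
    (∀ τ ∈ M, ∃ σ ∈ K, ∀ w ∈ τ, (p w).support ⊆ σ) ∧
    Set.BijOn (fun x : W →₀ ℝ => Finsupp.linearCombination ℝ p x) M.realization K.realization

/-- `K` is a PL sphere: some (finite) subdivision of `K` is also a subdivision of the boundary
complex of a simplex. The simplex may be a point (`n = 0`), and then `K = {∅}`. -/
def IsPLSphere {V : Type*} (K : PreAbstractSimplicialComplex V) : Prop :=
  ∃ (n : ℕ) (M : PreAbstractSimplicialComplex ℕ), M.faces.Finite ∧
    M.IsSubdivision K ∧ M.IsSubdivision (boundary (Finset.univ : Finset (Fin (n + 1))))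

/-- `K` is a wedge of a PL sphere, at one of its vertices. Since a complex isomorphic to a wedge
`wed_v(L)` is itself such a wedge after renaming the vertices of `L`, it is enough to consider
complexes `L` with vertices in the same supply of names. -/
def IsWedgeOfPLSphere {V : Type*} [DecidableEq V] (K : PreAbstractSimplicialComplex V) : Prop :=
  ∃ (L : PreAbstractSimplicialComplex V) (v v' : V),
    L.IsPLSphere ∧ {v} ∈ L ∧ {v'} ∉ L ∧ K = L.wedge v v'

/-- A seed is a PL sphere that is not a wedge of any PL sphere. -/
def IsSeed {V : Type*} [DecidableEq V] (K : PreAbstractSimplicialComplex V) : Prop :=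
  K.IsPLSphere ∧ ¬ K.IsWedgeOfPLSphere

/-- `K` is suspended: it is the suspension of some PL sphere (up to names of vertices). -/
def IsSuspended {V : Type*} [DecidableEq V] (K : PreAbstractSimplicialComplex V) : Prop :=
  ∃ (L : PreAbstractSimplicialComplex V) (a b : V),
    L.IsPLSphere ∧ a ≠ b ∧ {a} ∉ L ∧ {b} ∉ L ∧ K = L.suspension a b

/-- The complex `K(J)`. Its vertices are the copies `(v, i)`, written `v^(i)`, of the vertices `v` of
`K` with `0 ≤ i < J v`; its minimal non-faces are the minimal non-faces of `K` with every vertex `v`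
replaced by all its copies. So a set of copies is a face if and only if there is no nonempty
non-face of `K` all of whose copies it contains. -/
def iteratedWedge {V : Type*} (K : PreAbstractSimplicialComplex V) (J : V → ℕ) :
    PreAbstractSimplicialComplex (V × ℕ) where
  faces := {s | s.Nonempty ∧ (∀ x ∈ s, x.2 < J x.1) ∧
    ∀ t : Finset V, t.Nonempty → (∀ v ∈ t, ∀ i < J v, (v, i) ∈ s) → t ∈ K}
  isRelLowerSet_faces := fun {_} h => ⟨h.1, fun _ hts ht => ⟨ht, fun x hx => h.2.1 x (hts hx),
    fun t htn hc => h.2.2 t htn fun v hv i hi => hts (hc v hv i hi)⟩⟩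

/-- With only one copy of each vertex, `K(1, …, 1)` is `K`. -/
theorem iteratedWedge_one {V : Type*} [DecidableEq V] (K : PreAbstractSimplicialComplex V) :
    K.iteratedWedge (fun _ => 1) = K.map (fun v => (v, 0)) := by
  ext s
  constructor
  · rintro ⟨hs, h0, h⟩
    have hz : ∀ x ∈ s, x = (x.1, 0) := fun x hx => Prod.ext rfl (by simpa using h0 x hx)
    refine ⟨s.image Prod.fst, h _ (hs.image _) ?_, ?_⟩
    · intro v hv i hi
      obtain ⟨x, hx, rfl⟩ := Finset.mem_image.mp hv
      obtain rfl : i = 0 := Nat.lt_one_iff.mp hi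
      exact hz x hx ▸ hx
    · ext x
      simp only [Finset.mem_image]
      constructor
      · rintro ⟨_, ⟨y, hy, rfl⟩, rfl⟩
        exact hz y hy ▸ hy
      · exact fun hx => ⟨x.1, ⟨x, hx, rfl⟩, (hz x hx).symm⟩
  · rintro ⟨t, ht, rfl⟩
    have htn := (K.isRelLowerSet_faces ht).1
    refine ⟨htn.image _, ?_, fun r hr hc => (K.isRelLowerSet_faces ht).2 ?_ hr⟩
    · intro x hx
      obtain ⟨v, -, rfl⟩ := Finset.mem_image.mp hx
      exact Nat.one_pos
    · intro v hv
      obtain ⟨u, hu, he⟩ := Finset.mem_image.mp (hc v hv 0 Nat.one_pos)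
      obtain rfl : u = v := (Prod.ext_iff.mp he).1
      exact hu

/-- `K(J)` is obtained by wedge operations: one more copy of `v` is one more wedge at `v`. -/
theorem iteratedWedge_succ {V : Type*} [DecidableEq V] (K : AbstractSimplicialComplex V)
    (J : V → ℕ) (hJ : ∀ u, 1 ≤ J u) (v : V) :
    K.iteratedWedge (Function.update J v (J v + 1)) =
      (K.iteratedWedge J).wedge (v, 0) (v, J v) := by
  have hJv := hJ v
  have hle : ∀ u, J u ≤ Function.update J v (J v + 1) u := by
    intro u
    by_cases hu : u = v
    · subst hu; simp
    · simp [hu]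
  have hself : Function.update J v (J v + 1) v = J v + 1 := by simp
  have hne : ∀ u, u ≠ v → Function.update J v (J v + 1) u = J u := fun u hu => by simp [hu]
  set J' := Function.update J v (J v + 1)
  have hcopy : ∀ u i, i < J' u → i < J u ∨ (u = v ∧ i = J v) := by
    intro u i hi
    by_cases hu : u = v
    · subst hu
      rw [hself] at hi
      rcases Nat.lt_succ_iff_lt_or_eq.mp hi with h | h
      exacts [Or.inl h, Or.inr ⟨rfl, h⟩]
    · rw [hne u hu] at hi; exact Or.inl hi
  ext s
  constructor
  · rintro ⟨hsn, hb, h⟩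
    have hsplit : s = (s ∩ {(v, 0), (v, J v)}) ∪ (s \ {(v, 0), (v, J v)}) := by
      ext x; by_cases hx : x ∈ ({(v, 0), (v, J v)} : Finset (V × ℕ)) <;> simp [hx]
    have hBb : ∀ x ∈ s \ {(v, 0), (v, J v)}, x.2 < J x.1 := by
      intro x hx
      simp only [Finset.mem_sdiff, Finset.mem_insert, Finset.mem_singleton, not_or] at hx
      rcases hcopy _ _ (hb x hx.1) with h | ⟨h1, h2⟩
      · exact h
      · exact absurd (Prod.ext h1 h2) hx.2.2
    by_cases hboth : (v, 0) ∈ s ∧ (v, J v) ∈ s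
    · left
      refine ⟨hsn, _, _, ?_, ?_, hsplit⟩
      · exact Or.inr ⟨⟨(v, 0), by simp [hboth.1]⟩, Finset.inter_subset_right⟩
      · rcases (s \ {(v, 0), (v, J v)}).eq_empty_or_nonempty with he | he
        · exact Or.inl he
        · have hmem : (s \ {(v, 0), (v, J v)}) ∪ {(v, 0)} ∈ K.iteratedWedge J := by
            refine ⟨he.mono Finset.subset_union_left, ?_, fun t ht hc => h t ht ?_⟩
            · intro x hx
              rcases Finset.mem_union.mp hx with hx | hx
              · exact hBb x hx
              · rw [Finset.mem_singleton.mp hx]; exact hJv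
            · intro u hu i hi
              rcases hcopy u i hi with hi | ⟨rfl, rfl⟩
              · rcases Finset.mem_union.mp (hc u hu i hi) with hx | hx
                · exact (Finset.mem_sdiff.mp hx).1
                · rw [Finset.mem_singleton.mp hx]; exact hboth.1
              · exact hboth.2
          refine Or.inr ⟨?_, hmem, by ext; simp⟩
          exact ((K.iteratedWedge J).isRelLowerSet_faces hmem).2 Finset.subset_union_left he
    · right
      refine ⟨hsn, _, _, ?_, ?_, hsplit⟩
      · rcases (s ∩ {(v, 0), (v, J v)}).eq_empty_or_nonempty with he | he
        · exact Or.inl he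
        · refine Or.inr ⟨he, Finset.inter_subset_right, fun hsub => hboth ?_⟩
          exact ⟨(Finset.mem_inter.mp (hsub (by simp))).1, (Finset.mem_inter.mp (hsub (by simp))).1⟩
      · rcases (s \ {(v, 0), (v, J v)}).eq_empty_or_nonempty with he | he
        · exact Or.inl he
        · refine Or.inr ⟨⟨he, hBb, fun t ht hc => h t ht ?_⟩, by simp⟩
          intro u hu i hi
          rcases hcopy u i hi with hi | ⟨rfl, rfl⟩
          · exact (Finset.mem_sdiff.mp (hc u hu i hi)).1
          · exact absurd (hc u hu 0 hJv) (by simp)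
  · have hmemA : ∀ {A : Finset (V × ℕ)}, A ⊆ {(v, 0), (v, J v)} → ∀ x ∈ A,
        x = (v, 0) ∨ x = (v, J v) := fun hA x hx => by simpa using hA hx
    have hAb : ∀ x : V × ℕ, x = (v, 0) ∨ x = (v, J v) → x.2 < J' x.1 := by
      rintro x (rfl | rfl) <;> simp only [hself] <;> omega
    rintro (⟨hsn, A, B, hA, hB, rfl⟩ | ⟨hsn, A, B, hA, hB, rfl⟩)
    · have hA' : A ⊆ {(v, 0), (v, J v)} := by
        rcases hA with rfl | hA
        · simp
        · exact hA.2
      have hmem : B ∪ {(v, 0)} ∈ K.iteratedWedge J := by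
        rcases hB with rfl | hB
        · refine ⟨by simp, by simp; omega, fun t ht hc => ?_⟩
          have : t ⊆ {v} := fun u hu => by
            have := hc u hu 0 (hJ u)
            simpa using this
          rw [(Finset.Nonempty.subset_singleton_iff ht).mp this]
          exact K.singleton_mem v
        · exact hB.2.1
      refine ⟨hsn, ?_, fun t ht hc => hmem.2.2 t ht ?_⟩
      · intro x hx
        rcases Finset.mem_union.mp hx with hx | hx
        · exact hAb x (hmemA hA' x hx)
        · exact (hmem.2.1 x (Finset.mem_union_left _ hx)).trans_le (hle _)
      · intro u hu i hi
        rcases Finset.mem_union.mp (hc u hu i (hi.trans_le (hle u))) with hx | hx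
        · rcases hmemA hA' _ hx with he | he
          · simp [he]
          · obtain ⟨h1, h2⟩ := Prod.mk.inj he
            subst h1
            omega
        · exact Finset.mem_union_left _ hx
    · have hA' : A ⊆ {(v, 0), (v, J v)} ∧ ¬ ((v, 0) ∈ A ∧ (v, J v) ∈ A) := by
        rcases hA with rfl | hA
        · simp
        · exact ⟨hA.2.1, fun hh => hA.2.2 (by
            intro x hx
            rcases (by simpa using hx : x = (v, 0) ∨ x = (v, J v)) with rfl | rfl
            exacts [hh.1, hh.2])⟩
      have hBb : ∀ x ∈ B, x.2 < J x.1 ∧ x ≠ (v, 0) := by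
        rcases hB with rfl | hB
        · simp
        · exact fun x hx => ⟨hB.1.2.1 x hx, fun he => hB.2 (he ▸ hx)⟩
      refine ⟨hsn, ?_, fun t ht hc => ?_⟩
      · intro x hx
        rcases Finset.mem_union.mp hx with hx | hx
        · exact hAb x (hmemA hA'.1 x hx)
        · exact (hBb x hx).1.trans_le (hle _)
      · have hvt : v ∉ t := by
          intro hv
          refine hA'.2 ⟨?_, ?_⟩
          · rcases Finset.mem_union.mp (hc v hv 0 (by omega)) with hx | hx
            · exact hx
            · exact absurd rfl (hBb _ hx).2
          · rcases Finset.mem_union.mp (hc v hv (J v) (by omega)) with hx | hx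
            · exact hx
            · exact absurd (hBb _ hx).1 (lt_irrefl _)
        have hcB : ∀ u ∈ t, ∀ i < J u, (u, i) ∈ B := by
          intro u hu i hi
          rcases Finset.mem_union.mp (hc u hu i (hi.trans_le (hle u))) with hx | hx
          · have : u = v := by
              rcases hmemA hA'.1 _ hx with he | he <;> exact (Prod.ext_iff.mp he).1
            exact absurd (this ▸ hu) hvt
          · exact hx
        rcases hB with rfl | hB
        · obtain ⟨u, hu⟩ := ht
          exact absurd (hcB u hu 0 (hJ u)) (by simp)
        · exact hB.1.2.2 t ht hcB

/-- The assembled face of `K(J)` by `(s_1, …, s_m)`: the set of the copies `v^(s_v)`, taken over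
the vertices `v` with `J v ≠ 1`. -/
def assembledFace {m : ℕ} (J s : Fin m → ℕ) : Finset (Fin m × ℕ) :=
  (Finset.univ.filter fun v => J v ≠ 1).image fun v => (v, s v)

end PreAbstractSimplicialComplex

namespace PreAbstractSimplicialComplex

variable {U V W : Type*}

/-! The argument reduces everything to twins (`IsTwin`): two vertices such that a simplex missing
one of them stays a simplex when the other is added. In a PL sphere, twins `a`, `b` spanning an edge
exhibit the sphere as a wedge of the link of `b`, and twins not spanning an edge exhibit it as a
suspension of that link (`IsTwin.isWedgeOfPLSphere`, `IsTwin.isSuspended`). Conversely, a wedge has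
adjacent twins and a suspension has non-adjacent ones. Hence a PL sphere is a seed if and only if it
has no adjacent twins, and a non-suspended seed is a PL sphere without any twins.

In the first part only `v` is doubled, so `K(J)` is one wedge, and its subdivision at the edge of
the two copies is the suspension of `K` with `v` renamed to the new vertex (`stellar_wedge`).
Adjacent twins of a suspension avoid the apices, so they would be adjacent twins of `K`.

In the second part `σ` becomes a minimal non-face, so twins lie both inside or both outside it. Two
vertices of `σ`, or two copies outside `σ`, that are twins come from twins of `K`. If the new vertex
had a twin, any two doubled vertices would be twins of `K`, and there are at least two
(`not_isTwin_stellar_iteratedWedge`).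

The topological input is that links of vertices, suspensions, wedges and stellar subdivisions of PL
spheres are PL spheres. It rests on common refinements (`exists_common_subdivision`), which make PL
sphericity invariant under finite subdivision in both directions. Subdivisions are treated
homogeneously, as bijections of cones: scaling then costs nothing, and stellar subdivision,
suspension and link become operations on coordinates. -/

theorem nonempty_of_mem {K : PreAbstractSimplicialComplex V} {s : Finset V} (hs : s ∈ K) :
    s.Nonempty :=
  (K.isRelLowerSet_faces hs).1

theorem IsSimplex.mem {K : PreAbstractSimplicialComplex V} {s : Finset V} (hs : K.IsSimplex s)
    (h : s.Nonempty) : s ∈ K :=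
  hs.resolve_left h.ne_empty

theorem IsSimplex.singleton_mem {K : PreAbstractSimplicialComplex V} {s : Finset V}
    (hs : K.IsSimplex s) {v : V} (hv : v ∈ s) : {v} ∈ K :=
  (hs.mono (Finset.singleton_subset_iff.mpr hv)).mem (Finset.singleton_nonempty v)

theorem mem_iff_isSimplex {K : PreAbstractSimplicialComplex V} {s : Finset V} :
    s ∈ K ↔ K.IsSimplex s ∧ s.Nonempty :=
  ⟨fun h => ⟨Or.inr h, nonempty_of_mem h⟩, fun h => h.1.mem h.2⟩

theorem ext_isSimplex {K L : PreAbstractSimplicialComplex V}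
    (h : ∀ s, K.IsSimplex s ↔ L.IsSimplex s) : K = L :=
  SetLike.ext fun s => by rw [mem_iff_isSimplex, mem_iff_isSimplex, h s]

/-- The cone over the geometric realization: all families of nonnegative coordinates whose support
is a possibly empty simplex. -/
def cone (K : PreAbstractSimplicialComplex V) : Set (V →₀ ℝ) :=
  {x | (∀ v, 0 ≤ x v) ∧ K.IsSimplex x.support}

/-! ### Nonnegative combinations and coordinate sums -/

section Finsupp

theorem linearCombination_apply_apply (p : W → V →₀ ℝ) (x : W →₀ ℝ) (v : V) :
    Finsupp.linearCombination ℝ p x v = ∑ w ∈ x.support, x w * p w v := by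
  simp [Finsupp.linearCombination_apply, Finsupp.sum, Finsupp.finsetSum_apply]

theorem exists_of_mem_support_linearCombination {p : W → V →₀ ℝ} {x : W →₀ ℝ} {v : V}
    (h : v ∈ (Finsupp.linearCombination ℝ p x).support) :
    ∃ w ∈ x.support, v ∈ (p w).support := by
  rw [Finsupp.mem_support_iff, linearCombination_apply_apply] at h
  obtain ⟨w, hw, hne⟩ := Finset.exists_ne_zero_of_sum_ne_zero h
  exact ⟨w, hw, Finsupp.mem_support_iff.mpr (right_ne_zero_of_mul hne)⟩

theorem linearCombination_nonneg {p : W → V →₀ ℝ} {x : W →₀ ℝ} (hx : ∀ w, 0 ≤ x w)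
    (hp : ∀ w ∈ x.support, ∀ v, 0 ≤ p w v) (v : V) :
    0 ≤ Finsupp.linearCombination ℝ p x v := by
  rw [linearCombination_apply_apply]
  exact Finset.sum_nonneg fun w hw => mul_nonneg (hx w) (hp w hw v)

theorem mem_support_linearCombination {p : W → V →₀ ℝ} {x : W →₀ ℝ} (hx : ∀ w, 0 ≤ x w)
    (hp : ∀ w ∈ x.support, ∀ v, 0 ≤ p w v) {w : W} (hw : w ∈ x.support) {v : V}
    (hv : v ∈ (p w).support) : v ∈ (Finsupp.linearCombination ℝ p x).support := by
  rw [Finsupp.mem_support_iff, linearCombination_apply_apply]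
  refine (Finset.sum_pos' (fun w hw => mul_nonneg (hx w) (hp w hw v)) ⟨w, hw, ?_⟩).ne'
  exact mul_pos (lt_of_le_of_ne (hx w) (Finsupp.mem_support_iff.mp hw).symm)
    (lt_of_le_of_ne (hp w hw v) (Finsupp.mem_support_iff.mp hv).symm)

/-- The sum of the coordinates. -/
noncomputable def total : (V →₀ ℝ) →ₗ[ℝ] ℝ := Finsupp.linearCombination ℝ fun _ => 1

theorem total_eq_sum (x : V →₀ ℝ) : total x = x.sum fun _ c => c := by
  simp [total, Finsupp.linearCombination_apply]

theorem total_pos {x : V →₀ ℝ} (hx : ∀ v, 0 ≤ x v) (h : x ≠ 0) : 0 < total x := by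
  rw [total_eq_sum, Finsupp.sum]
  obtain ⟨v, hv⟩ := Finsupp.support_nonempty_iff.mpr h
  exact Finset.sum_pos' (fun v _ => hx v)
    ⟨v, hv, lt_of_le_of_ne (hx v) (Finsupp.mem_support_iff.mp hv).symm⟩

theorem total_linearCombination (p : W → V →₀ ℝ) (x : W →₀ ℝ) :
    total (Finsupp.linearCombination ℝ p x) = ∑ w ∈ x.support, x w * total (p w) := by
  rw [Finsupp.linearCombination_apply, Finsupp.sum, map_sum]
  simp

theorem linearCombination_congr {p q : W → V →₀ ℝ} {x : W →₀ ℝ}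
    (h : ∀ w ∈ x.support, p w = q w) :
    Finsupp.linearCombination ℝ p x = Finsupp.linearCombination ℝ q x := by
  rw [Finsupp.linearCombination_apply, Finsupp.linearCombination_apply]
  exact Finset.sum_congr rfl fun w hw => by simp [h w hw]

theorem linearCombination_smul_left (a : W → ℝ) (p : W → V →₀ ℝ) (x : W →₀ ℝ) :
    Finsupp.linearCombination ℝ (fun w => a w • p w) x =
      Finsupp.linearCombination ℝ p (a • x) := by
  ext v
  rw [linearCombination_apply_apply, linearCombination_apply_apply]
  symm
  refine (Finset.sum_subset (s₂ := x.support) ?_ ?_).trans ?_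
  · intro w hw
    simp only [Finsupp.mem_support_iff, Finsupp.coe_pointwise_smul, Pi.smul_apply',
      smul_eq_mul] at hw ⊢
    exact right_ne_zero_of_mul hw
  · intro w _ hw
    rw [Finsupp.notMem_support_iff.mp hw, zero_mul]
  · refine Finset.sum_congr rfl fun w _ => ?_
    simp only [Finsupp.coe_pointwise_smul, Pi.smul_apply', smul_eq_mul, Finsupp.smul_apply]
    ring

end Finsupp

/-! ### Cones over realizations -/

section Cone

variable {K : PreAbstractSimplicialComplex V}

theorem zero_mem_cone : (0 : V →₀ ℝ) ∈ K.cone :=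
  ⟨fun _ => le_rfl, Or.inl Finsupp.support_zero⟩

theorem mem_cone_of_support_subset {x : V →₀ ℝ} {s : Finset V} (hs : K.IsSimplex s)
    (h0 : ∀ v, 0 ≤ x v) (h : x.support ⊆ s) : x ∈ K.cone :=
  ⟨h0, hs.mono h⟩

theorem smul_mem_cone {x : V →₀ ℝ} (hx : x ∈ K.cone) {c : ℝ} (hc : 0 ≤ c) : c • x ∈ K.cone :=
  mem_cone_of_support_subset hx.2 (fun v => mul_nonneg hc (hx.1 v)) Finsupp.support_smul

theorem single_mem_cone {v : V} (hv : {v} ∈ K) {c : ℝ} (hc : 0 ≤ c) :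
    Finsupp.single v c ∈ K.cone :=
  mem_cone_of_support_subset (Or.inr hv)
    (fun u => by classical rw [Finsupp.single_apply]; split_ifs <;> simp [hc])
    Finsupp.support_single_subset

theorem mem_realization_iff {x : V →₀ ℝ} :
    x ∈ K.realization ↔ x ∈ K.cone ∧ total x = 1 := by
  rw [total_eq_sum]
  constructor
  · rintro ⟨h0, h1, h2⟩
    exact ⟨⟨h0, Or.inr h2⟩, h1⟩
  · rintro ⟨⟨h0, h2⟩, h1⟩
    refine ⟨h0, h1, h2.mem (Finsupp.support_nonempty_iff.mpr ?_)⟩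
    rintro rfl
    simp at h1

theorem normalize_mem_realization {x : V →₀ ℝ} (hx : x ∈ K.cone) (h0 : x ≠ 0) :
    (total x)⁻¹ • x ∈ K.realization := by
  have := total_pos hx.1 h0
  exact mem_realization_iff.mpr ⟨smul_mem_cone hx (inv_pos.mpr this).le, by
    rw [map_smul, smul_eq_mul, inv_mul_cancel₀ this.ne']⟩

end Cone

/-! ### Subdivisions in homogeneous coordinates -/

/-- The homogeneous form of a subdivision: the vertices of `M` are sent to rays, and the cone over
`M` is mapped bijectively to the cone over `K`. -/
structure IsConeSubdivision (p : W → V →₀ ℝ) (M : PreAbstractSimplicialComplex W)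
    (K : PreAbstractSimplicialComplex V) : Prop where
  carrier : ∀ τ ∈ M, ∃ σ ∈ K, ∀ w ∈ τ, (p w).support ⊆ σ
  bijOn : Set.BijOn (Finsupp.linearCombination ℝ p) M.cone K.cone

theorem mapsTo_cone {p : W → V →₀ ℝ} {M : PreAbstractSimplicialComplex W}
    {K : PreAbstractSimplicialComplex V} (hc : ∀ τ ∈ M, ∃ σ ∈ K, ∀ w ∈ τ, (p w).support ⊆ σ)
    (hp : ∀ w, {w} ∈ M → ∀ v, 0 ≤ p w v) :
    Set.MapsTo (Finsupp.linearCombination ℝ p) M.cone K.cone := by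
  intro x hx
  rcases hx.2 with h | h
  · rw [Finsupp.support_eq_empty.mp h, map_zero]
    exact zero_mem_cone
  · obtain ⟨σ, hσ, hs⟩ := hc _ h
    refine mem_cone_of_support_subset (Or.inr hσ)
      (linearCombination_nonneg hx.1 fun w hw => hp w (hx.2.singleton_mem hw)) fun v hv => ?_
    obtain ⟨w, hw, hv⟩ := exists_of_mem_support_linearCombination hv
    exact hs w hw hv

namespace IsConeSubdivision

variable {p : W → V →₀ ℝ} {M : PreAbstractSimplicialComplex W} {K : PreAbstractSimplicialComplex V}

theorem vertex_mem_cone (h : IsConeSubdivision p M K) {w : W} (hw : {w} ∈ M) : p w ∈ K.cone := by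
  simpa using h.bijOn.mapsTo (single_mem_cone hw zero_le_one)

theorem vertex_ne_zero (h : IsConeSubdivision p M K) {w : W} (hw : {w} ∈ M) : p w ≠ 0 := by
  intro h0
  have := h.bijOn.injOn (single_mem_cone hw zero_le_one) zero_mem_cone (by simp [h0])
  simp at this

/-- Rays carry no scale: dividing each `p w` by its coordinate sum places the vertices of `M` in the
realization of `K`. In the cone over `M` this amounts to a positive rescaling of the coordinates,
which is invertible. -/
theorem isSubdivision (h : IsConeSubdivision p M K) : M.IsSubdivision K := by
  set a : W → ℝ := fun w => (total (p w))⁻¹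
  have ha : ∀ w, {w} ∈ M → 0 < total (p w) := fun w hw =>
    total_pos (h.vertex_mem_cone hw).1 (h.vertex_ne_zero hw)
  have hscale : ∀ (b : W → ℝ) (x : W →₀ ℝ), (∀ w, {w} ∈ M → 0 < b w) → x ∈ M.cone →
      b • x ∈ M.cone := by
    intro b x hb hx
    have hs : (b • x).support ⊆ x.support := fun w hw => by
      simp only [Finsupp.mem_support_iff, Finsupp.coe_pointwise_smul, Pi.smul_apply',
        smul_eq_mul] at hw ⊢
      exact right_ne_zero_of_mul hw
    refine mem_cone_of_support_subset hx.2 (fun w => ?_) hs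
    by_cases hw : w ∈ x.support
    · exact mul_nonneg (hb w (hx.2.singleton_mem hw)).le (hx.1 w)
    · simp [Finsupp.notMem_support_iff.mp hw]
  have ha' : ∀ w, {w} ∈ M → 0 < a w := fun w hw => inv_pos.mpr (ha w hw)
  have htot : ∀ x ∈ M.cone, total (Finsupp.linearCombination ℝ (fun w => a w • p w) x)
      = total x := by
    intro x hx
    rw [total_linearCombination, total_eq_sum, Finsupp.sum]
    refine Finset.sum_congr rfl fun w hw => ?_
    rw [map_smul, smul_eq_mul, inv_mul_cancel₀ (ha w (hx.2.singleton_mem hw)).ne', mul_one]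
  refine ⟨fun w => a w • p w, fun τ hτ => ?_, ?_, ?_, ?_⟩
  · obtain ⟨σ, hσ, hs⟩ := h.carrier τ hτ
    exact ⟨σ, hσ, fun w hw => Finsupp.support_smul.trans (hs w hw)⟩
  · intro x hx
    rw [mem_realization_iff] at hx ⊢
    refine ⟨?_, (htot x hx.1).trans hx.2⟩
    change Finsupp.linearCombination ℝ (fun w => a w • p w) x ∈ K.cone
    rw [linearCombination_smul_left]
    exact h.bijOn.mapsTo (hscale a x ha' hx.1)
  · intro x hx y hy hxy
    rw [mem_realization_iff] at hx hy
    simp only [linearCombination_smul_left] at hxy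
    have := h.bijOn.injOn (hscale a x ha' hx.1) (hscale a y ha' hy.1) hxy
    ext w
    by_cases hw : {w} ∈ M
    · have := DFunLike.congr_fun this w
      simpa [(ha' w hw).ne'] using this
    · have hz : ∀ z ∈ M.cone, z w = 0 := fun z hz => by
        by_contra hne
        exact hw (hz.2.singleton_mem (Finsupp.mem_support_iff.mpr hne))
      rw [hz x hx.1, hz y hy.1]
  · intro u hu
    rw [mem_realization_iff] at hu
    obtain ⟨z, hz, rfl⟩ := h.bijOn.surjOn hu.1
    have hx := hscale (fun w => total (p w)) z ha hz
    have hz' : Finsupp.linearCombination ℝ (fun w => a w • p w) ((fun w => total (p w)) • z) =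
        Finsupp.linearCombination ℝ p z := by
      rw [linearCombination_smul_left]
      congr 1
      ext w
      by_cases hw : w ∈ z.support
      · have := (ha w (hz.2.singleton_mem hw)).ne'
        simp only [Finsupp.coe_pointwise_smul, Pi.smul_apply', smul_eq_mul, Pi.mul_apply, a]
        field_simp
      · simp [Finsupp.notMem_support_iff.mp hw]
    refine ⟨_, mem_realization_iff.mpr ⟨hx, ?_⟩, hz'⟩
    rw [← htot _ hx, hz', hu.2]

end IsConeSubdivision

/-- The vertices of `M` sit at points of coordinate sum `1`, so the linear map preserves coordinate
sums. Nonzero points of the cones can therefore be normalized, and bijectivity on realizations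
spreads to the cones with the same `p`. -/
theorem IsSubdivision.exists_isConeSubdivision {M : PreAbstractSimplicialComplex W}
    {K : PreAbstractSimplicialComplex V} (h : M.IsSubdivision K) :
    ∃ p, IsConeSubdivision p M K := by
  obtain ⟨p, hc, hm, hi, hs⟩ := h
  have htot : ∀ x ∈ M.cone, total (Finsupp.linearCombination ℝ p x) = total x := by
    intro x hx
    rw [total_linearCombination, total_eq_sum, Finsupp.sum]
    refine Finset.sum_congr rfl fun w hw => ?_
    have hw' := hx.2.singleton_mem hw
    have : Finsupp.single w (1 : ℝ) ∈ M.realization :=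
      mem_realization_iff.mpr ⟨single_mem_cone hw' zero_le_one, by simp [total]⟩
    have := (mem_realization_iff.mp (hm this)).2
    beta_reduce at this
    rw [Finsupp.linearCombination_single, one_smul] at this
    rw [this, mul_one]
  refine ⟨p, hc, ?_, ?_, ?_⟩
  · intro x hx
    by_cases h0 : x = 0
    · rw [h0, map_zero]; exact zero_mem_cone
    · have h1 := (mem_realization_iff.mp (hm (normalize_mem_realization hx h0))).1
      beta_reduce at h1
      have h2 := smul_mem_cone h1 (total_pos hx.1 h0).le
      rwa [map_smul, smul_smul, mul_inv_cancel₀ (total_pos hx.1 h0).ne', one_smul] at h2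
  · intro x hx y hy hxy
    have ht : total x = total y := by rw [← htot x hx, ← htot y hy, hxy]
    by_cases h0 : x = 0
    · by_contra hne
      have := total_pos hy.1 (fun hy0 => hne (h0.trans hy0.symm))
      rw [← ht, h0, map_zero] at this
      exact lt_irrefl _ this
    · have hpos := total_pos hx.1 h0
      have hy0 : y ≠ 0 := by
        rintro rfl
        rw [ht, map_zero] at hpos
        exact lt_irrefl _ hpos
      have := hi (normalize_mem_realization hx h0) (normalize_mem_realization hy hy0) (by simp only [map_smul, hxy, ht])
      rw [← ht] at this
      exact smul_right_injective _ (inv_pos.mpr hpos).ne' this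
  · intro u hu
    by_cases h0 : u = 0
    · exact ⟨0, zero_mem_cone, by rw [map_zero, h0]⟩
    · obtain ⟨x, hx, hxu⟩ := hs (normalize_mem_realization hu h0)
      refine ⟨total u • x, smul_mem_cone (mem_realization_iff.mp hx).1 (total_pos hu.1 h0).le, ?_⟩
      change Finsupp.linearCombination ℝ p x = _ at hxu
      rw [map_smul, hxu, smul_smul, mul_inv_cancel₀ (total_pos hu.1 h0).ne', one_smul]

namespace IsConeSubdivision

theorem trans {L : PreAbstractSimplicialComplex U} {M : PreAbstractSimplicialComplex W}
    {K : PreAbstractSimplicialComplex V} {q : U → W →₀ ℝ} {p : W → V →₀ ℝ}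
    (hq : IsConeSubdivision q L M) (hp : IsConeSubdivision p M K) :
    IsConeSubdivision (fun u => Finsupp.linearCombination ℝ p (q u)) L K := by
  refine ⟨fun τ hτ => ?_, (hp.bijOn.comp hq.bijOn).congr fun x _ => ?_⟩
  · obtain ⟨σ, hσ, hs⟩ := hq.carrier τ hτ
    obtain ⟨ρ, hρ, ht⟩ := hp.carrier σ hσ
    refine ⟨ρ, hρ, fun w hw v hv => ?_⟩
    obtain ⟨u, hu, hv⟩ := exists_of_mem_support_linearCombination hv
    exact ht u (hs w hw hu) hv
  · simp [Finsupp.linearCombination_apply, Finsupp.sum, map_sum]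

theorem map [DecidableEq V] (M : PreAbstractSimplicialComplex W) (f : W → V)
    (hf : Set.InjOn f {w | {w} ∈ M}) :
    IsConeSubdivision (fun w => Finsupp.single (f w) 1) M (M.map f) := by
  have hc : ∀ τ ∈ M, ∃ σ ∈ M.map f, ∀ w ∈ τ,
      (Finsupp.single (f w) (1 : ℝ)).support ⊆ σ := fun τ hτ =>
    ⟨τ.image f, ⟨τ, hτ, rfl⟩, fun w hw => Finsupp.support_single_subset.trans
      (Finset.singleton_subset_iff.mpr (Finset.mem_image_of_mem f hw))⟩
  have happ : ∀ x ∈ M.cone, ∀ w, {w} ∈ M →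
      Finsupp.linearCombination ℝ (fun w => Finsupp.single (f w) (1 : ℝ)) x (f w) = x w := by
    intro x hx w hw
    rw [linearCombination_apply_apply]
    rw [Finset.sum_eq_single w]
    · simp
    · intro u hu huw
      rw [Finsupp.single_apply, if_neg (fun h => huw (hf (hx.2.singleton_mem hu) hw h)), mul_zero]
    · intro h
      rw [Finsupp.notMem_support_iff.mp h, zero_mul]
  refine ⟨hc, mapsTo_cone hc fun w _ v => ?_, fun x hx y hy hxy => ?_, fun u hu => ?_⟩
  · rw [Finsupp.single_apply]; split_ifs <;> simp
  · ext w
    by_cases hw : {w} ∈ M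
    · rw [← happ x hx w hw, ← happ y hy w hw, hxy]
    · have hz : ∀ z ∈ M.cone, z w = 0 := fun z hz => by
        by_contra hne
        exact hw (hz.2.singleton_mem (Finsupp.mem_support_iff.mpr hne))
      rw [hz x hx, hz y hy]
  · obtain h | ⟨τ, hτ, hτu⟩ := hu.2
    · exact ⟨0, zero_mem_cone, by rw [map_zero, Finsupp.support_eq_empty.mp h]⟩
    · classical
      have hτs : ∀ w ∈ τ, {w} ∈ M := fun w hw => IsSimplex.singleton_mem (Or.inr hτ) hw
      set z : W →₀ ℝ := Finsupp.onFinset τ (fun w => if w ∈ τ then u (f w) else 0)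
        (fun w hw => by by_contra h; simp [h] at hw)
      have hz : z ∈ M.cone := mem_cone_of_support_subset (Or.inr hτ)
        (fun w => by simp only [z, Finsupp.onFinset_apply]; split_ifs <;> simp [hu.1])
        Finsupp.support_onFinset_subset
      refine ⟨z, hz, ?_⟩
      ext v
      by_cases hv : v ∈ u.support
      · rw [← hτu] at hv
        obtain ⟨w, hw, rfl⟩ := Finset.mem_image.mp hv
        rw [happ z hz w (hτs w hw)]
        simp [z, hw]
      · rw [Finsupp.notMem_support_iff.mp hv]
        by_contra hne
        obtain ⟨w, hw, hvw⟩ :=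
          exists_of_mem_support_linearCombination (Finsupp.mem_support_iff.mpr hne)
        have hvw := Finset.mem_singleton.mp (Finsupp.support_single_subset hvw)
        refine hv (hτu ▸ ?_)
        rw [hvw]
        exact Finset.mem_image_of_mem f (Finsupp.support_onFinset_subset hw)

end IsConeSubdivision

/-! ### Renaming vertices -/

theorem map_map_of_leftInv [DecidableEq V] [DecidableEq W] {M : PreAbstractSimplicialComplex W}
    {f : W → V} {g : V → W} (h : ∀ w, {w} ∈ M → g (f w) = w) : (M.map f).map g = M := by
  have key : ∀ t ∈ M, (t.image f).image g = t := by
    intro t ht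
    rw [Finset.image_image]
    refine (Finset.image_congr fun w hw => ?_).trans Finset.image_id
    exact h w (IsSimplex.singleton_mem (Or.inr ht) hw)
  ext s
  constructor
  · rintro ⟨_, ⟨t, ht, rfl⟩, rfl⟩
    have ht : t ∈ M := ht
    change (t.image f).image g ∈ M
    rwa [key t ht]
  · intro hs
    exact ⟨s.image f, ⟨s, hs, rfl⟩, key s hs⟩

theorem singleton_mem_map [DecidableEq V] {M : PreAbstractSimplicialComplex W}
    {f : W → V} {v : V} : {v} ∈ M.map f ↔ ∃ w, {w} ∈ M ∧ f w = v := by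
  constructor
  · rintro ⟨t, ht, hv⟩
    have hv : t.image f = {v} := hv
    obtain ⟨w, hw, hwv⟩ := Finset.mem_image.mp (hv ▸ Finset.mem_singleton_self v)
    exact ⟨w, IsSimplex.singleton_mem (Or.inr ht) hw, hwv⟩
  · rintro ⟨w, hw, rfl⟩
    exact ⟨{w}, hw, Finset.image_singleton f w⟩

theorem IsConeSubdivision.map_symm [DecidableEq V] [DecidableEq W]
    {M : PreAbstractSimplicialComplex W} {f : W → V} {g : V → W}
    (h : ∀ w, {w} ∈ M → g (f w) = w) :
    IsConeSubdivision (fun v => Finsupp.single (g v) 1) (M.map f) M := by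
  have := IsConeSubdivision.map (M.map f) g ?_
  · rwa [map_map_of_leftInv h] at this
  · intro a ha b hb hab
    obtain ⟨u, hu, rfl⟩ := singleton_mem_map.mp ha
    obtain ⟨v, hv, rfl⟩ := singleton_mem_map.mp hb
    rw [h u hu, h v hv] at hab
    rw [hab]

theorem finite_vertices {K : PreAbstractSimplicialComplex V} (hK : K.faces.Finite) :
    {v | {v} ∈ K}.Finite := by
  refine Set.Finite.of_finite_image (f := fun v : V => ({v} : Finset V))
    (hK.subset ?_) fun a _ b _ h => Finset.singleton_injective h
  rintro _ ⟨u, hu, rfl⟩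
  exact hu

/-- `IsPLSphere` wants its subdivision to have natural numbers as vertices, while common refinements
are built on pairs of finite sets. -/
theorem exists_natural_copy [Nonempty U] (N : PreAbstractSimplicialComplex U)
    (hN : N.faces.Finite) :
    ∃ (N' : PreAbstractSimplicialComplex ℕ) (r : ℕ → U), N'.faces.Finite ∧
      IsConeSubdivision (fun n => Finsupp.single (r n) 1) N' N ∧ ∀ n, {n} ∈ N' → {r n} ∈ N := by
  classical
  obtain ⟨f, hf⟩ := Set.countable_iff_exists_injOn.mp (finite_vertices hN).countable
  have hg : ∀ u, {u} ∈ N → Function.invFunOn f {u | {u} ∈ N} (f u) = u := fun u hu =>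
    hf.leftInvOn_invFunOn hu
  refine ⟨N.map f, Function.invFunOn f {u | {u} ∈ N}, hN.image _,
    IsConeSubdivision.map_symm hg, fun n hn => ?_⟩
  obtain ⟨u, hu, rfl⟩ := singleton_mem_map.mp hn
  rwa [hg u hu]

/-! ### Common refinement of two subdivisions -/

theorem exists_sub_smul_nonneg {x b : W →₀ ℝ} (hx : ∀ w, 0 ≤ x w) (hb : ∀ w, 0 ≤ b w)
    (hs : b.support ⊆ x.support) (h0 : b ≠ 0) :
    ∃ t : ℝ, 0 < t ∧ (∀ t' ≤ t, ∀ w, 0 ≤ (x - t' • b) w) ∧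
      ∃ w ∈ b.support, (x - t • b) w = 0 := by
  have hpos : ∀ {y : W →₀ ℝ}, (∀ w, 0 ≤ y w) → ∀ w ∈ y.support, 0 < y w := fun hy w hw =>
    lt_of_le_of_ne (hy w) (Finsupp.mem_support_iff.mp hw).symm
  -- The ratio test: the smallest quotient is the largest multiple of `b` that can be subtracted,
  -- and its minimizer is the coordinate that vanishes.
  obtain ⟨w, hw, hmin⟩ := Finset.exists_min_image b.support (fun w => x w / b w)
    (Finsupp.support_nonempty_iff.mpr h0)
  refine ⟨x w / b w, div_pos (hpos hx w (hs hw)) (hpos hb w hw), fun t' ht' u => ?_, w, hw, ?_⟩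
  · rw [Finsupp.sub_apply, Finsupp.smul_apply, smul_eq_mul, sub_nonneg]
    by_cases hu : u ∈ b.support
    · exact (le_div_iff₀ (hpos hb u hu)).mp (ht'.trans (hmin u hu))
    · rw [Finsupp.notMem_support_iff.mp hu, mul_zero]
      exact hx u
  · rw [Finsupp.sub_apply, Finsupp.smul_apply, smul_eq_mul,
      div_mul_cancel₀ _ (hpos hb w hw).ne', sub_self]

/-- Nonnegative vectors do not cancel, so along a chain of supports the largest one survives. -/
theorem support_linearCombination_eq {b : U → W →₀ ℝ} {z : U →₀ ℝ} (hz : ∀ u, 0 ≤ z u)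
    (hb : ∀ u ∈ z.support, ∀ w, 0 ≤ b u w) {m : U} (hm : m ∈ z.support)
    (h : ∀ u ∈ z.support, (b u).support ⊆ (b m).support) :
    (Finsupp.linearCombination ℝ b z).support = (b m).support := by
  ext w
  constructor
  · intro hw
    obtain ⟨u, hu, hwu⟩ := exists_of_mem_support_linearCombination hw
    exact h u hu hwu
  · exact fun hw => mem_support_linearCombination hz hb hm hw

/-- The order complex of a set of elements of a partial order: its simplices are the chains. -/
def orderComplex {P : Type*} [PartialOrder P] (S : Set P) : PreAbstractSimplicialComplex P where
  faces := {t | t.Nonempty ∧ ↑t ⊆ S ∧ IsChain (· ≤ ·) (t : Set P)}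
  isRelLowerSet_faces := fun {_} h => ⟨h.1, fun _ hts ht =>
    ⟨ht, (Finset.coe_subset.mpr hts).trans h.2.1, h.2.2.mono (Finset.coe_subset.mpr hts)⟩⟩

theorem orderComplex_exists_top {P : Type*} [PartialOrder P] {S : Set P} {t : Finset P}
    (ht : t ∈ orderComplex S) : ∃ m ∈ t, m ∈ S ∧ ∀ u ∈ t, u ≤ m := by
  obtain ⟨m, hm⟩ := t.exists_maximal ht.1
  refine ⟨m, hm.1, ht.2.1 hm.1, fun u hu => ?_⟩
  rcases ht.2.2.total hu hm.1 with h | h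
  · exact h
  · exact hm.2 hu h

section Refinement

variable {W₁ W₂ : Type*} {M₁ : PreAbstractSimplicialComplex W₁}
  {M₂ : PreAbstractSimplicialComplex W₂} {K : PreAbstractSimplicialComplex V}
  {p₁ : W₁ → V →₀ ℝ} {p₂ : W₂ → V →₀ ℝ}

/-- The supports of the two images recover the top pair of the chain. Subtracting the smaller of the
two coefficients of that top pair from both sides preserves both equations and removes it from at
least one of `z`, `z'`, so induction on the total size of the supports applies. -/
theorem orderComplex_injective {S : Set (Finset W₁ × Finset W₂)}
    {b₁ : Finset W₁ × Finset W₂ → W₁ →₀ ℝ} {b₂ : Finset W₁ × Finset W₂ → W₂ →₀ ℝ}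
    (hb₁ : ∀ π ∈ S, ∀ w, 0 ≤ b₁ π w) (hb₂ : ∀ π ∈ S, ∀ w, 0 ≤ b₂ π w)
    (hs₁ : ∀ π ∈ S, (b₁ π).support = π.1) (hs₂ : ∀ π ∈ S, (b₂ π).support = π.2)
    (hne : ∀ π ∈ S, b₁ π ≠ 0) :
    ∀ (n : ℕ) (z z' : Finset W₁ × Finset W₂ →₀ ℝ), z.support.card + z'.support.card ≤ n →
      z ∈ (orderComplex S).cone → z' ∈ (orderComplex S).cone →
      Finsupp.linearCombination ℝ b₁ z = Finsupp.linearCombination ℝ b₁ z' →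
      Finsupp.linearCombination ℝ b₂ z = Finsupp.linearCombination ℝ b₂ z' → z = z' := by
  have top : ∀ z ∈ (orderComplex S).cone, z ≠ 0 → ∃ m ∈ z.support, m ∈ S ∧
      (Finsupp.linearCombination ℝ b₁ z).support = m.1 ∧
      (Finsupp.linearCombination ℝ b₂ z).support = m.2 := by
    intro z hz h0
    have hz' := hz.2.mem (Finsupp.support_nonempty_iff.mpr h0)
    obtain ⟨m, hm, hmS, hle⟩ := orderComplex_exists_top hz'
    refine ⟨m, hm, hmS, ?_, ?_⟩
    · rw [← hs₁ m hmS]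
      refine support_linearCombination_eq hz.1 (fun u hu => hb₁ u (hz'.2.1 hu)) hm fun u hu => ?_
      rw [hs₁ m hmS, hs₁ u (hz'.2.1 hu)]
      exact (hle u hu).1
    · rw [← hs₂ m hmS]
      refine support_linearCombination_eq hz.1 (fun u hu => hb₂ u (hz'.2.1 hu)) hm fun u hu => ?_
      rw [hs₂ m hmS, hs₂ u (hz'.2.1 hu)]
      exact (hle u hu).2
  have zero : ∀ z ∈ (orderComplex S).cone, Finsupp.linearCombination ℝ b₁ z = 0 → z = 0 := by
    intro z hz h
    by_contra h0
    obtain ⟨m, -, hmS, h1, -⟩ := top z hz h0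
    rw [h, Finsupp.support_zero, ← hs₁ m hmS] at h1
    exact hne m hmS (Finsupp.support_eq_empty.mp h1.symm)
  intro n
  induction n with
  | zero =>
    intro z z' hn _ _ _ _
    have h1 : z.support.card = 0 := by omega
    have h2 : z'.support.card = 0 := by omega
    rw [Finset.card_eq_zero, Finsupp.support_eq_empty] at h1 h2
    rw [h1, h2]
  | succ n ih =>
    intro z z' hn hz hz' h1 h2
    by_cases h0 : z = 0
    · rw [h0, map_zero] at h1
      rw [h0, zero z' hz' h1.symm]
    by_cases h0' : z' = 0
    · rw [h0', map_zero] at h1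
      rw [h0', zero z hz h1]
    obtain ⟨m, hm, hmS, e1, e2⟩ := top z hz h0
    obtain ⟨m', hm', hmS', e1', e2'⟩ := top z' hz' h0'
    obtain rfl : m = m' := Prod.ext (by rw [← e1, h1, e1']) (by rw [← e2, h2, e2'])
    set c := min (z m) (z' m) with hc
    have hsub : ∀ y ∈ (orderComplex S).cone, m ∈ y.support → c ≤ y m →
        (y - Finsupp.single m c).support ⊆ y.support ∧
        y - Finsupp.single m c ∈ (orderComplex S).cone := by
      intro y hy hmy hcy
      classical
      have hsupp : (y - Finsupp.single m c).support ⊆ y.support := by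
        intro u hu
        by_cases hum : u = m
        · rwa [hum]
        · simpa [hum, Finsupp.single_apply, Ne.symm hum] using hu
      refine ⟨hsupp, mem_cone_of_support_subset hy.2 (fun u => ?_) hsupp⟩
      rw [Finsupp.sub_apply, Finsupp.single_apply]
      split_ifs with h
      · subst h; linarith
      · simpa using hy.1 u
    obtain ⟨hy, hyc⟩ := hsub z hz hm (min_le_left _ _)
    obtain ⟨hy', hyc'⟩ := hsub z' hz' hm' (min_le_right _ _)
    have hcard : (z - Finsupp.single m c).support.card +
        (z' - Finsupp.single m c).support.card ≤ n := by
      have l1 := Finset.card_le_card hy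
      have l2 := Finset.card_le_card hy'
      rcases min_choice (z m) (z' m) with h | h
      · have : m ∉ (z - Finsupp.single m c).support := by simp [hc, h]
        have := Finset.card_lt_card ((Finset.ssubset_iff_of_subset hy).mpr ⟨m, hm, this⟩)
        omega
      · have : m ∉ (z' - Finsupp.single m c).support := by simp [hc, h]
        have := Finset.card_lt_card ((Finset.ssubset_iff_of_subset hy').mpr ⟨m, hm', this⟩)
        omega
    have := ih _ _ hcard hyc hyc' (by rw [map_sub, map_sub, h1]) (by rw [map_sub, map_sub, h2])
    exact sub_left_injective this

/-- As for barycentric subdivision: given two points with the same image, subtract from both the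
largest common multiple of the marked points of their cell. One support shrinks, and the remainder
is treated by induction. The bound on `z.support` ensures that the new pair lies above the chain
found so far. -/
theorem orderComplex_surjective (h₁ : IsConeSubdivision p₁ M₁ K) (h₂ : IsConeSubdivision p₂ M₂ K)
    {S : Set (Finset W₁ × Finset W₂)}
    {b₁ : Finset W₁ × Finset W₂ → W₁ →₀ ℝ} {b₂ : Finset W₁ × Finset W₂ → W₂ →₀ ℝ}
    (hS : ∀ x₁ ∈ M₁.cone, ∀ x₂ ∈ M₂.cone, Finsupp.linearCombination ℝ p₁ x₁ =
      Finsupp.linearCombination ℝ p₂ x₂ → x₁ ≠ 0 → (x₁.support, x₂.support) ∈ S)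
    (hb₁ : ∀ π ∈ S, b₁ π ∈ M₁.cone) (hb₂ : ∀ π ∈ S, b₂ π ∈ M₂.cone)
    (hs₁ : ∀ π ∈ S, (b₁ π).support = π.1) (hs₂ : ∀ π ∈ S, (b₂ π).support = π.2)
    (hne : ∀ π ∈ S, b₁ π ≠ 0)
    (hcomp : ∀ π ∈ S, Finsupp.linearCombination ℝ p₁ (b₁ π) =
      Finsupp.linearCombination ℝ p₂ (b₂ π)) :
    ∀ (n : ℕ) (x₁ : W₁ →₀ ℝ) (x₂ : W₂ →₀ ℝ), x₁.support.card + x₂.support.card ≤ n →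
      x₁ ∈ M₁.cone → x₂ ∈ M₂.cone →
      Finsupp.linearCombination ℝ p₁ x₁ = Finsupp.linearCombination ℝ p₂ x₂ →
      ∃ z ∈ (orderComplex S).cone, Finsupp.linearCombination ℝ b₁ z = x₁ ∧
        Finsupp.linearCombination ℝ b₂ z = x₂ ∧
        ∀ π ∈ z.support, π ≤ (x₁.support, x₂.support) := by
  have zero_left : ∀ x₂ ∈ M₂.cone, 0 = Finsupp.linearCombination ℝ p₂ x₂ → x₂ = 0 :=
    fun x₂ hx₂ h => h₂.bijOn.injOn hx₂ zero_mem_cone (by rw [← h, map_zero])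
  have zero_right : ∀ x₁ ∈ M₁.cone, Finsupp.linearCombination ℝ p₁ x₁ = 0 → x₁ = 0 :=
    fun x₁ hx₁ h => h₁.bijOn.injOn hx₁ zero_mem_cone (by rw [h, map_zero])
  intro n
  induction n with
  | zero =>
    intro x₁ x₂ hn _ _ _
    have e1 : x₁.support.card = 0 := by omega
    have e2 : x₂.support.card = 0 := by omega
    rw [Finset.card_eq_zero, Finsupp.support_eq_empty] at e1 e2
    exact ⟨0, zero_mem_cone, by simp [e1], by simp [e2], by simp⟩
  | succ n ih =>
    intro x₁ x₂ hn hx₁ hx₂ hx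
    by_cases h0 : x₁ = 0
    · have h0' : x₂ = 0 := zero_left x₂ hx₂ (by rw [← hx, h0, map_zero])
      exact ⟨0, zero_mem_cone, by simp [h0], by simp [h0'], by simp⟩
    set π : Finset W₁ × Finset W₂ := (x₁.support, x₂.support) with hπ
    have hπS : π ∈ S := hS x₁ hx₁ x₂ hx₂ hx h0
    have s1 : (b₁ π).support = x₁.support := hs₁ π hπS
    have s2 : (b₂ π).support = x₂.support := hs₂ π hπS
    have n2 : b₂ π ≠ 0 := fun h => hne π hπS (zero_right _ (hb₁ π hπS) (by
      rw [hcomp π hπS, h, map_zero]))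
    obtain ⟨t₁, ht₁, hle₁, w₁, hw₁, hz₁⟩ :=
      exists_sub_smul_nonneg hx₁.1 (hb₁ π hπS).1 s1.subset (hne π hπS)
    obtain ⟨t₂, ht₂, hle₂, w₂, hw₂, hz₂⟩ :=
      exists_sub_smul_nonneg hx₂.1 (hb₂ π hπS).1 s2.subset n2
    set t := min t₁ t₂ with ht
    have htpos : 0 < t := lt_min ht₁ ht₂
    have sub1 : (x₁ - t • b₁ π).support ⊆ x₁.support := by
      intro u hu
      by_contra h
      have h' : u ∉ (b₁ π).support := s1 ▸ h
      simp [Finsupp.notMem_support_iff.mp h, Finsupp.notMem_support_iff.mp h'] at hu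
    have sub2 : (x₂ - t • b₂ π).support ⊆ x₂.support := by
      intro u hu
      by_contra h
      have h' : u ∉ (b₂ π).support := s2 ▸ h
      simp [Finsupp.notMem_support_iff.mp h, Finsupp.notMem_support_iff.mp h'] at hu
    have hcard : (x₁ - t • b₁ π).support.card + (x₂ - t • b₂ π).support.card ≤ n := by
      have l1 := Finset.card_le_card sub1
      have l2 := Finset.card_le_card sub2
      rcases min_choice t₁ t₂ with h | h
      · have : w₁ ∉ (x₁ - t • b₁ π).support := by
          rw [Finsupp.notMem_support_iff, ht, h, hz₁]
        have := Finset.card_lt_card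
          ((Finset.ssubset_iff_of_subset sub1).mpr ⟨w₁, s1 ▸ hw₁, this⟩)
        omega
      · have : w₂ ∉ (x₂ - t • b₂ π).support := by
          rw [Finsupp.notMem_support_iff, ht, h, hz₂]
        have := Finset.card_lt_card
          ((Finset.ssubset_iff_of_subset sub2).mpr ⟨w₂, s2 ▸ hw₂, this⟩)
        omega
    obtain ⟨z, hz, e1, e2, hle⟩ := ih _ _ hcard
      (mem_cone_of_support_subset hx₁.2 (hle₁ t (min_le_left _ _)) sub1)
      (mem_cone_of_support_subset hx₂.2 (hle₂ t (min_le_right _ _)) sub2)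
      (by rw [map_sub, map_sub, map_smul, map_smul, hx, hcomp π hπS])
    have hle' : ∀ u ∈ z.support, u ≤ π := fun u hu => (hle u hu).trans ⟨sub1, sub2⟩
    classical
    have hsupp : (z + Finsupp.single π t).support ⊆ insert π z.support := by
      refine Finsupp.support_add.trans (Finset.union_subset (Finset.subset_insert _ _) ?_)
      exact Finsupp.support_single_subset.trans (by simp)
    have hface : insert π z.support ∈ orderComplex S := by
      have hzS : ∀ u ∈ z.support, u ∈ S := fun u hu => by
        rcases hz.2 with h | h
        · simp [h] at hu
        · exact h.2.1 hu
      have hzc : IsChain (· ≤ ·) (z.support : Set (Finset W₁ × Finset W₂)) := by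
        rcases hz.2 with h | h
        · rw [h]; simp
        · exact h.2.2
      refine ⟨Finset.insert_nonempty _ _, ?_, ?_⟩
      · intro u hu
        rcases Finset.mem_insert.mp hu with rfl | hu
        exacts [hπS, hzS u hu]
      · rw [Finset.coe_insert]
        exact hzc.insert fun u hu _ => Or.inr (hle' u hu)
    refine ⟨z + Finsupp.single π t, mem_cone_of_support_subset (Or.inr hface) (fun u => ?_) hsupp,
      ?_, ?_, fun u hu => ?_⟩
    · rw [Finsupp.add_apply, Finsupp.single_apply]
      have := hz.1 u
      split_ifs <;> linarith
    · rw [map_add, e1, Finsupp.linearCombination_single, sub_add_cancel]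
    · rw [map_add, e2, Finsupp.linearCombination_single, sub_add_cancel]
    · rcases Finset.mem_insert.mp (hsupp hu) with rfl | hu
      exacts [le_rfl, hle' u hu]

/-- Two finite subdivisions of a complex have a common subdivision. -/
theorem exists_common_subdivision (h₁ : IsConeSubdivision p₁ M₁ K)
    (h₂ : IsConeSubdivision p₂ M₂ K) (f₁ : M₁.faces.Finite) (f₂ : M₂.faces.Finite) :
    ∃ (N : PreAbstractSimplicialComplex ℕ) (q₁ : ℕ → W₁ →₀ ℝ) (q₂ : ℕ → W₂ →₀ ℝ),
      N.faces.Finite ∧ IsConeSubdivision q₁ N M₁ ∧ IsConeSubdivision q₂ N M₂ ∧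
      ∀ n, {n} ∈ N → Finsupp.linearCombination ℝ p₁ (q₁ n) =
        Finsupp.linearCombination ℝ p₂ (q₂ n) := by
  -- A pair in `S` records the simplices of `M₁` and `M₂` that contain one nonzero point in their
  -- interiors; these pairs index the cells of the intersection of the two subdivisions.
  set S : Set (Finset W₁ × Finset W₂) := {π | ∃ x₁ ∈ M₁.cone, ∃ x₂ ∈ M₂.cone,
    Finsupp.linearCombination ℝ p₁ x₁ = Finsupp.linearCombination ℝ p₂ x₂ ∧ x₁ ≠ 0 ∧
    x₁.support = π.1 ∧ x₂.support = π.2} with hSdef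
  have hex : ∀ π ∈ S, ∃ (x₁ : W₁ →₀ ℝ) (x₂ : W₂ →₀ ℝ), x₁ ∈ M₁.cone ∧ x₂ ∈ M₂.cone ∧
      Finsupp.linearCombination ℝ p₁ x₁ = Finsupp.linearCombination ℝ p₂ x₂ ∧ x₁ ≠ 0 ∧
      x₁.support = π.1 ∧ x₂.support = π.2 := by
    rintro π ⟨x₁, hx₁, x₂, hx₂, h⟩
    exact ⟨x₁, x₂, hx₁, hx₂, h⟩
  -- One interior point of each cell, seen in both coordinate systems, plays the role of its
  -- barycentre.
  choose! b₁ b₂ hb₁ hb₂ hcomp hne hs₁ hs₂ using hex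
  have hS : ∀ x₁ ∈ M₁.cone, ∀ x₂ ∈ M₂.cone, Finsupp.linearCombination ℝ p₁ x₁ =
      Finsupp.linearCombination ℝ p₂ x₂ → x₁ ≠ 0 → (x₁.support, x₂.support) ∈ S :=
    fun x₁ hx₁ x₂ hx₂ h h0 => ⟨x₁, hx₁, x₂, hx₂, h, h0, rfl, rfl⟩
  have hne₂ : ∀ π ∈ S, b₂ π ≠ 0 := fun π hπ h => hne π hπ
    (h₁.bijOn.injOn (hb₁ π hπ) zero_mem_cone (by rw [hcomp π hπ, h, map_zero, map_zero]))
  have hvert : ∀ π, {π} ∈ orderComplex S → π ∈ S := fun π hπ => hπ.2.1 (by simp)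
  have hfin : S.Finite := by
    refine (f₁.prod f₂).subset ?_
    intro π hπ
    refine ⟨?_, ?_⟩
    · rw [← hs₁ π hπ]
      exact (hb₁ π hπ).2.mem (Finsupp.support_nonempty_iff.mpr (hne π hπ))
    · rw [← hs₂ π hπ]
      exact (hb₂ π hπ).2.mem (Finsupp.support_nonempty_iff.mpr (hne₂ π hπ))
  have hfin' : (orderComplex S).faces.Finite :=
    (hfin.finite_subsets.preimage Finset.coe_injective.injOn).subset fun t ht => ht.2.1
  have hcar : ∀ τ ∈ orderComplex S, (∃ σ ∈ M₁, ∀ π ∈ τ, (b₁ π).support ⊆ σ) ∧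
      ∃ σ ∈ M₂, ∀ π ∈ τ, (b₂ π).support ⊆ σ := by
    intro τ hτ
    obtain ⟨m, hm, hmS, hle⟩ := orderComplex_exists_top hτ
    refine ⟨⟨_, (hb₁ m hmS).2.mem (Finsupp.support_nonempty_iff.mpr (hne m hmS)), fun π hπ => ?_⟩,
      ⟨_, (hb₂ m hmS).2.mem (Finsupp.support_nonempty_iff.mpr (hne₂ m hmS)), fun π hπ => ?_⟩⟩
    · rw [hs₁ m hmS, hs₁ π (hτ.2.1 hπ)]
      exact (hle π hπ).1
    · rw [hs₂ m hmS, hs₂ π (hτ.2.1 hπ)]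
      exact (hle π hπ).2
  have hmap₁ := mapsTo_cone (fun τ hτ => (hcar τ hτ).1) fun π hπ => (hb₁ π (hvert π hπ)).1
  have hmap₂ := mapsTo_cone (fun τ hτ => (hcar τ hτ).2) fun π hπ => (hb₂ π (hvert π hπ)).1
  have hcomp' : ∀ z ∈ (orderComplex S).cone,
      Finsupp.linearCombination ℝ p₁ (Finsupp.linearCombination ℝ b₁ z) =
      Finsupp.linearCombination ℝ p₂ (Finsupp.linearCombination ℝ b₂ z) := by
    intro z hz
    rw [Finsupp.linearCombination_apply ℝ (v := b₁), Finsupp.linearCombination_apply ℝ (v := b₂),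
      Finsupp.sum, Finsupp.sum, map_sum, map_sum]
    refine Finset.sum_congr rfl fun π hπ => ?_
    rw [map_smul, map_smul, hcomp π (hvert π (hz.2.singleton_mem hπ))]
  have hinj := orderComplex_injective (fun π hπ => (hb₁ π hπ).1) (fun π hπ => (hb₂ π hπ).1)
    hs₁ hs₂ hne
  have hsurj := orderComplex_surjective h₁ h₂ hS hb₁ hb₂ hs₁ hs₂ hne hcomp
  have sub₁ : IsConeSubdivision b₁ (orderComplex S) M₁ := by
    refine ⟨fun τ hτ => (hcar τ hτ).1, hmap₁, fun z hz z' hz' h => ?_, fun x₁ hx₁ => ?_⟩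
    -- `orderComplex_injective` needs equality in both coordinate systems; the second follows from
    -- the first because `p₂` is injective on the cone.
    · refine hinj _ z z' le_rfl hz hz' h (h₂.bijOn.injOn (hmap₂ hz) (hmap₂ hz') ?_)
      rw [← hcomp' z hz, ← hcomp' z' hz', h]
    · obtain ⟨x₂, hx₂, h⟩ := h₂.bijOn.surjOn (h₁.bijOn.mapsTo hx₁)
      obtain ⟨z, hz, e, -⟩ := hsurj _ x₁ x₂ le_rfl hx₁ hx₂ h.symm
      exact ⟨z, hz, e⟩
  have sub₂ : IsConeSubdivision b₂ (orderComplex S) M₂ := by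
    refine ⟨fun τ hτ => (hcar τ hτ).2, hmap₂, fun z hz z' hz' h => ?_, fun x₂ hx₂ => ?_⟩
    · refine hinj _ z z' le_rfl hz hz' (h₁.bijOn.injOn (hmap₁ hz) (hmap₁ hz') ?_) h
      rw [hcomp' z hz, hcomp' z' hz', h]
    · obtain ⟨x₁, hx₁, h⟩ := h₁.bijOn.surjOn (h₂.bijOn.mapsTo hx₂)
      obtain ⟨z, hz, -, e, -⟩ := hsurj _ x₁ x₂ le_rfl hx₁ hx₂ h
      exact ⟨z, hz, e⟩
  obtain ⟨N, r, hN, hr, hrv⟩ := exists_natural_copy _ hfin'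
  refine ⟨N, _, _, hN, hr.trans sub₁, hr.trans sub₂, fun n hn => ?_⟩
  simp only [Finsupp.linearCombination_single, one_smul]
  exact hcomp _ (hvert _ (hrv n hn))

end Refinement

/-! ### Membership tests for the constructions -/

section IsSimplex

variable {K L : PreAbstractSimplicialComplex V}

theorem isSimplex_empty : K.IsSimplex ∅ := Or.inl rfl

theorem isSimplex_simplex {σ s : Finset V} : (simplex σ).IsSimplex s ↔ s ⊆ σ := by
  constructor
  · rintro (rfl | h)
    · exact Finset.empty_subset _
    · exact h.2
  · intro h
    rcases s.eq_empty_or_nonempty with hs | hs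
    · exact Or.inl hs
    · exact Or.inr ⟨hs, h⟩

theorem isSimplex_boundary {σ s : Finset V} (hσ : σ.Nonempty) :
    (boundary σ).IsSimplex s ↔ s ⊂ σ := by
  constructor
  · rintro (rfl | h)
    · exact Finset.empty_ssubset.mpr hσ
    · exact h.2
  · intro h
    rcases s.eq_empty_or_nonempty with hs | hs
    · exact Or.inl hs
    · exact Or.inr ⟨hs, h⟩

theorem isSimplex_sup {s : Finset V} :
    (K ⊔ L).IsSimplex s ↔ K.IsSimplex s ∨ L.IsSimplex s := by
  have : s ∈ K ⊔ L ↔ s ∈ K ∨ s ∈ L := Iff.rfl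
  rw [IsSimplex, IsSimplex, IsSimplex, this]
  tauto

theorem isSimplex_deletion {v : V} {s : Finset V} :
    (K.deletion v).IsSimplex s ↔ K.IsSimplex s ∧ v ∉ s := by
  constructor
  · rintro (rfl | h)
    · exact ⟨Or.inl rfl, by simp⟩
    · exact ⟨Or.inr h.1, h.2⟩
  · rintro ⟨rfl | h, hv⟩
    exacts [Or.inl rfl, Or.inr ⟨h, hv⟩]


variable [DecidableEq V]

theorem isSimplex_join {s : Finset V} :
    (K.join L).IsSimplex s ↔ ∃ σ τ, K.IsSimplex σ ∧ L.IsSimplex τ ∧ s = σ ∪ τ := by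
  constructor
  · rintro (rfl | h)
    · exact ⟨∅, ∅, Or.inl rfl, Or.inl rfl, rfl⟩
    · exact h.2
  · intro h
    rcases s.eq_empty_or_nonempty with hs | hs
    · exact Or.inl hs
    · exact Or.inr ⟨hs, h⟩

theorem isSimplex_boundary_pair {a b : V} {s : Finset V} :
    (boundary {a, b}).IsSimplex s ↔ s ⊆ {a, b} ∧ ¬ (a ∈ s ∧ b ∈ s) := by
  rw [isSimplex_boundary (by simp), Finset.ssubset_def]
  refine and_congr_right fun _ => not_congr ?_
  simp [Finset.insert_subset_iff]

theorem isSimplex_link {σ s : Finset V} (hσ : K.IsSimplex σ) :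
    (K.link σ).IsSimplex s ↔ K.IsSimplex (s ∪ σ) ∧ Disjoint σ s := by
  constructor
  · rintro (rfl | h)
    · simpa using hσ
    · exact ⟨Or.inr h.2.1, Finset.disjoint_iff_inter_eq_empty.mpr h.2.2⟩
  · rintro ⟨h, hd⟩
    rcases s.eq_empty_or_nonempty with hs | hs
    · exact Or.inl hs
    · exact Or.inr ⟨(h.mono Finset.subset_union_left).mem hs,
        h.mem (hs.mono Finset.subset_union_left), Finset.disjoint_iff_inter_eq_empty.mp hd⟩

theorem isSimplex_link_singleton {v : V} (hv : {v} ∈ K) {s : Finset V} :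
    (K.link {v}).IsSimplex s ↔ K.IsSimplex (insert v s) ∧ v ∉ s := by
  rw [isSimplex_link (Or.inr hv), Finset.disjoint_singleton_left, Finset.union_comm,
    Finset.insert_eq]

/-- Both pieces of the definition merge into one test: `σ` has become a non-face, and `w` joins
exactly with what was in the star of `σ`. With such tests later identities of complexes are checked
set by set. -/
theorem isSimplex_stellar {σ : Finset V} {w : V} (hσ : σ ∈ K) (hw : {w} ∉ K) {s : Finset V} :
    (K.stellar σ w).IsSimplex s ↔
      K.IsSimplex (s.erase w) ∧ ¬ σ ⊆ s ∧ (w ∈ s → K.IsSimplex (s.erase w ∪ σ)) := by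
  have hwσ : w ∉ σ := fun h => hw (IsSimplex.singleton_mem (Or.inr hσ) h)
  have key : (K.stellar σ w).IsSimplex s ↔ (K.IsSimplex s ∧ ¬ K.IsSimplex (s ∪ σ)) ∨
      ((simplex {w}).join ((boundary σ).join (K.link σ))).IsSimplex s := by
    rcases s.eq_empty_or_nonempty with rfl | hs
    · simp [isSimplex_empty]
    · have : s ∈ K.stellar σ w ↔ (s ∈ K ∧ ¬ (s ∈ K ∧ s ∪ σ ∈ K)) ∨
        s ∈ (simplex {w}).join ((boundary σ).join (K.link σ)) := Iff.rfl
      have hs' : s ∪ σ ≠ ∅ := (hs.mono Finset.subset_union_left).ne_empty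
      simp only [IsSimplex, hs.ne_empty, hs', false_or, this]
      tauto
  rw [key]
  simp only [isSimplex_join, isSimplex_simplex, isSimplex_boundary (nonempty_of_mem hσ),
    isSimplex_link (Or.inr hσ)]
  constructor
  · rintro (⟨hs, hsσ⟩ | ⟨A, _, hA, ⟨B, C, hB, ⟨hC, hd⟩, rfl⟩, rfl⟩)
    · have hws : w ∉ s := fun h => hw (hs.singleton_mem h)
      rw [Finset.erase_eq_of_notMem hws]
      exact ⟨hs, fun h => hsσ (by rwa [Finset.union_eq_left.mpr h]), fun h => absurd h hws⟩
    · have hsub : (A ∪ (B ∪ C)).erase w ⊆ B ∪ C := by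
        intro x hx
        obtain ⟨hxw, hx⟩ := Finset.mem_erase.mp hx
        rcases Finset.mem_union.mp hx with hx | hx
        · exact absurd (Finset.mem_singleton.mp (hA hx)) hxw
        · exact hx
      have hBC : (B ∪ C) ∪ σ ⊆ C ∪ σ := by
        intro x hx
        simp only [Finset.mem_union] at hx ⊢
        rcases hx with (hx | hx) | hx
        exacts [Or.inr (hB.subset hx), Or.inl hx, Or.inr hx]
      have h1 : K.IsSimplex ((A ∪ (B ∪ C)).erase w ∪ σ) :=
        hC.mono ((Finset.union_subset_union_left hsub).trans hBC)
      refine ⟨h1.mono Finset.subset_union_left, fun h => hB.2 fun x hx => ?_, fun _ => h1⟩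
      rcases Finset.mem_union.mp (h hx) with h | h
      · exact absurd (Finset.mem_singleton.mp (hA h) ▸ hx) hwσ
      · rcases Finset.mem_union.mp h with h | h
        · exact h
        · exact absurd h (Finset.disjoint_left.mp hd hx)
  · rintro ⟨h1, h2, h3⟩
    by_cases hwσ' : K.IsSimplex (s.erase w ∪ σ)
    · right
      refine ⟨s ∩ {w}, _, Finset.inter_subset_right, ⟨s ∩ σ, s.erase w \ σ, ?_, ⟨?_, ?_⟩, rfl⟩, ?_⟩
      · exact ⟨Finset.inter_subset_right, fun h => h2 (h.trans Finset.inter_subset_left)⟩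
      · rwa [Finset.sdiff_union_self_eq_union]
      · exact Finset.disjoint_sdiff
      · ext x
        simp only [Finset.mem_union, Finset.mem_inter, Finset.mem_singleton, Finset.mem_sdiff,
          Finset.mem_erase]
        tauto
    · left
      have hws : w ∉ s := fun h => hwσ' (h3 h)
      rw [Finset.erase_eq_of_notMem hws] at h1 hwσ'
      exact ⟨h1, hwσ'⟩

theorem isSimplex_suspension {a b : V} (ha : {a} ∉ K) (hb : {b} ∉ K)
    {s : Finset V} :
    (K.suspension a b).IsSimplex s ↔
      K.IsSimplex ((s.erase a).erase b) ∧ ¬ (a ∈ s ∧ b ∈ s) := by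
  simp only [suspension, isSimplex_join, isSimplex_boundary_pair]
  constructor
  · rintro ⟨A, B, ⟨hA, hn⟩, hB, rfl⟩
    have haB : a ∉ B := fun h => ha (hB.singleton_mem h)
    have hbB : b ∉ B := fun h => hb (hB.singleton_mem h)
    refine ⟨hB.mono fun x hx => ?_, ?_⟩
    · simp only [Finset.mem_erase, Finset.mem_union] at hx
      rcases hx.2.2 with h | h
      · have := hA h
        simp only [Finset.mem_insert, Finset.mem_singleton] at this
        tauto
      · exact h
    · simpa [haB, hbB] using hn
  · rintro ⟨h1, h2⟩
    refine ⟨s ∩ {a, b}, _, ⟨Finset.inter_subset_right, by simpa using h2⟩, h1, ?_⟩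
    ext x
    simp only [Finset.mem_union, Finset.mem_inter, Finset.mem_singleton, Finset.mem_insert,
      Finset.mem_erase]
    tauto

theorem isSimplex_wedge {v v' : V} (hv : {v} ∈ K) (hv' : {v'} ∉ K) {s : Finset V} :
    (K.wedge v v').IsSimplex s ↔ K.IsSimplex ((s.erase v).erase v') ∧
      (v ∈ s → v' ∈ s → K.IsSimplex (s.erase v')) := by
  have hne : v ≠ v' := by rintro rfl; exact hv' hv
  simp only [wedge, isSimplex_sup, isSimplex_join, isSimplex_boundary_pair, isSimplex_simplex,
    isSimplex_link_singleton hv, isSimplex_deletion]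
  have hsplit : s = s ∩ {v, v'} ∪ (s.erase v).erase v' := by
    ext x
    simp only [Finset.mem_union, Finset.mem_inter, Finset.mem_singleton, Finset.mem_insert,
      Finset.mem_erase]
    tauto
  have hsub : ∀ {A B : Finset V}, A ⊆ {v, v'} → ((A ∪ B).erase v).erase v' ⊆ B := by
    intro A B hA x hx
    simp only [Finset.mem_erase, Finset.mem_union] at hx
    rcases hx.2.2 with h | h
    · have := hA h
      simp only [Finset.mem_insert, Finset.mem_singleton] at this
      tauto
    · exact h
  constructor
  · rintro (⟨A, B, hA, ⟨hB, hvB⟩, rfl⟩ | ⟨A, B, ⟨hA, hn⟩, ⟨hB, hvB⟩, rfl⟩)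
    · refine ⟨(hB.mono (Finset.subset_insert _ _)).mono (hsub hA), fun _ _ => hB.mono ?_⟩
      intro x hx
      rw [Finset.mem_insert]
      by_cases hxv : x = v
      · exact Or.inl hxv
      · have := Finset.mem_erase.mp hx
        exact Or.inr (hsub hA (by simp [this.1, hxv, Finset.mem_union.mp this.2]))
    · refine ⟨hB.mono (hsub hA), fun h1 h2 => ?_⟩
      have hv'B : v' ∉ B := fun h => hv' (hB.singleton_mem h)
      exact absurd ⟨by simpa [hvB] using h1, by simpa [hv'B] using h2⟩ hn
  · rintro ⟨h1, h2⟩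
    by_cases hb : v ∈ s ∧ v' ∈ s
    · left
      refine ⟨s ∩ {v, v'}, _, Finset.inter_subset_right, ⟨?_, by simp⟩, hsplit⟩
      rw [Finset.erase_right_comm, Finset.insert_erase (Finset.mem_erase.mpr ⟨hne, hb.1⟩)]
      exact h2 hb.1 hb.2
    · right
      exact ⟨s ∩ {v, v'}, _, ⟨Finset.inter_subset_right, by simpa using hb⟩, ⟨h1, by simp⟩, hsplit⟩

end IsSimplex

theorem linearCombination_single_one (x : V →₀ ℝ) :
    Finsupp.linearCombination ℝ (fun v => Finsupp.single v (1 : ℝ)) x = x := by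
  ext v
  simp [Finsupp.linearCombination_apply]

/-! ### Stellar subdivisions are subdivisions -/

section Stellar

variable [DecidableEq V] {K : PreAbstractSimplicialComplex V}

/-- A stellar subdivision is a subdivision; the new vertex may be placed at any point in the
interior of the subdivided face. -/
theorem IsConeSubdivision.stellar {σ : Finset V} {w : V} (hσ : σ ∈ K) (hw : {w} ∉ K)
    {y : V →₀ ℝ} (hy : ∀ v, 0 ≤ y v) (hyσ : y.support = σ) :
    IsConeSubdivision (fun v => if v = w then y else Finsupp.single v 1) (K.stellar σ w) K := by
  have hwσ : w ∉ σ := fun h => hw (IsSimplex.singleton_mem (Or.inr hσ) h)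
  have hy0 : y ≠ 0 := by
    rintro rfl
    exact (nonempty_of_mem hσ).ne_empty (by simpa using hyσ.symm)
  have hcar : ∀ τ ∈ K.stellar σ w, ∃ ρ ∈ K, ∀ v ∈ τ,
      (if v = w then y else Finsupp.single v 1).support ⊆ ρ := by
    intro τ hτ
    obtain ⟨h1, -, h3⟩ := (isSimplex_stellar hσ hw).mp (Or.inr hτ)
    by_cases hwτ : w ∈ τ
    · refine ⟨_, (h3 hwτ).mem ((nonempty_of_mem hσ).mono Finset.subset_union_right), fun v hv => ?_⟩
      split_ifs with h
      · rw [hyσ]; exact Finset.subset_union_right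
      · refine Finsupp.support_single_subset.trans (Finset.singleton_subset_iff.mpr ?_)
        exact Finset.mem_union_left _ (Finset.mem_erase.mpr ⟨h, hv⟩)
    · rw [Finset.erase_eq_of_notMem hwτ] at h1
      refine ⟨τ, h1.mem (nonempty_of_mem hτ), fun v hv => ?_⟩
      rw [if_neg (ne_of_mem_of_not_mem hv hwτ)]
      exact Finsupp.support_single_subset.trans (Finset.singleton_subset_iff.mpr hv)
  have happ : ∀ z : V →₀ ℝ, Finsupp.linearCombination ℝ
      (fun v => if v = w then y else Finsupp.single v 1) z = z w • y + z.erase w := by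
    intro z
    conv_lhs => rw [← Finsupp.single_add_erase w z]
    rw [map_add, Finsupp.linearCombination_single, if_pos rfl]
    congr 1
    rw [linearCombination_congr (q := fun v => Finsupp.single v 1), linearCombination_single_one]
    intro v hv
    exact if_neg (fun h => by simp [h] at hv)
  have hface : ∀ z ∈ (K.stellar σ w).cone, ¬ σ ⊆ (z.erase w).support := by
    intro z hz h
    refine ((isSimplex_stellar hσ hw).mp hz.2).2.1 (h.trans ?_)
    rw [Finsupp.support_erase]
    exact Finset.erase_subset _ _
  -- Injectivity: if two points had the same image and different coordinates at `w`, the one with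
  -- the smaller coordinate would be positive on all of `σ`, which `hface` forbids.
  have hwe : ∀ z z' : V →₀ ℝ, (∀ v, 0 ≤ z' v) → z w < z' w →
      z w • y + z.erase w = z' w • y + z'.erase w → σ ⊆ (z.erase w).support := by
    intro z z' hz' hlt h v hv
    have := DFunLike.congr_fun h v
    have hyv : 0 < y v := lt_of_le_of_ne (hy v) (Finsupp.mem_support_iff.mp (hyσ ▸ hv)).symm
    have hz'v : 0 ≤ z'.erase w v := by
      rw [Finsupp.erase_apply]; split_ifs; exacts [le_rfl, hz' v]
    rw [Finsupp.add_apply, Finsupp.add_apply, Finsupp.smul_apply, Finsupp.smul_apply, smul_eq_mul,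
      smul_eq_mul] at this
    rw [Finsupp.mem_support_iff]
    nlinarith
  refine ⟨hcar, mapsTo_cone hcar fun v _ u => ?_, fun z hz z' hz' h => ?_, fun x hx => ?_⟩
  · split_ifs
    · exact hy u
    · rw [Finsupp.single_apply]; split_ifs <;> simp
  · rw [happ, happ] at h
    have heq : z w = z' w := by
      rcases lt_trichotomy (z w) (z' w) with hlt | heq | hlt
      · exact absurd (hwe z z' hz'.1 hlt h) (hface z hz)
      · exact heq
      · exact absurd (hwe z' z hz.1 hlt h.symm) (hface z' hz')
    rw [heq] at h
    rw [← Finsupp.single_add_erase w z, ← Finsupp.single_add_erase w z', heq,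
      add_left_cancel h]
  · have hxw : x w = 0 := by
      by_contra h
      exact hw (hx.2.singleton_mem (Finsupp.mem_support_iff.mpr h))
    have hyw : y w = 0 := by
      by_contra h
      exact hwσ (hyσ ▸ Finsupp.mem_support_iff.mpr h)
    -- Surjectivity: subtract the largest admissible multiple `t` of `y` and use `t` as the
    -- coordinate at `w`. Nothing is subtracted if `σ` is not contained in the support.
    suffices ∃ t : ℝ, 0 ≤ t ∧ (∀ v, 0 ≤ (x - t • y) v) ∧ ¬ σ ⊆ (x - t • y).support ∧
        (x - t • y).support ⊆ x.support ∧ (0 < t → σ ⊆ x.support) by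
      obtain ⟨t, ht, hnn, hσn, hsub, hpos⟩ := this
      have hxyw : (x - t • y) w = 0 := by simp [hxw, hyw]
      set z := x - t • y with hz
      have hzw : z.erase w = z := by
        ext v
        rw [Finsupp.erase_apply]
        split_ifs with h
        · rw [h, hxyw]
        · rfl
      have hsupp : (Finsupp.single w t + z).support ⊆ insert w z.support :=
        Finsupp.support_add.trans (by
          rw [Finset.insert_eq]
          exact Finset.union_subset_union_left Finsupp.support_single_subset)
      have hsw : ∀ v, v ≠ w → v ∈ (Finsupp.single w t + z).support → v ∈ z.support :=
        fun v hv h => (Finset.mem_insert.mp (hsupp h)).resolve_left hv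
      have herase : (Finsupp.single w t + z).support.erase w ⊆ z.support := fun v hv =>
        hsw v (Finset.ne_of_mem_erase hv) (Finset.mem_of_mem_erase hv)
      refine ⟨Finsupp.single w t + z, ⟨fun v => ?_, (isSimplex_stellar hσ hw).mpr
        ⟨hx.2.mono (herase.trans hsub), fun h => hσn fun v hv => ?_, fun h => ?_⟩⟩, ?_⟩
      · rw [Finsupp.add_apply, Finsupp.single_apply]
        have := hnn v
        split_ifs <;> linarith
      · exact hsw v (fun hvw => hwσ (hvw ▸ hv)) (h hv)
      · have htp : 0 < t := by
          refine lt_of_le_of_ne ht fun h0 => ?_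
          rw [← h0] at h
          simp [hxyw] at h
        exact hx.2.mono (Finset.union_subset (herase.trans hsub) (hpos htp))
      · rw [happ]
        simp only [Finsupp.add_apply, Finsupp.single_eq_same, hxyw, add_zero, Finsupp.erase_add,
          Finsupp.erase_single, zero_add, hzw]
        rw [hz]
        abel
    by_cases hσx : σ ⊆ x.support
    · obtain ⟨t, ht, hle, v, hv, hv0⟩ := exists_sub_smul_nonneg hx.1 hy (hyσ ▸ hσx) hy0
      refine ⟨t, ht.le, hle t le_rfl, fun h => ?_, fun u hu => ?_, fun _ => hσx⟩
      · exact Finsupp.mem_support_iff.mp (h (hyσ ▸ hv)) hv0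
      · by_contra hux
        have hyu : y u = 0 := by
          by_contra h
          exact hux (hσx (hyσ ▸ Finsupp.mem_support_iff.mpr h))
        simp [Finsupp.notMem_support_iff.mp hux, hyu] at hu
    · exact ⟨0, le_rfl, by simpa using hx.1, by simpa using hσx, by simp, by simp⟩

end Stellar

theorem apply_eq_zero_of_mem_cone {K : PreAbstractSimplicialComplex V} {x : V →₀ ℝ} {v : V}
    (hv : {v} ∉ K) (hx : x ∈ K.cone) : x v = 0 := by
  by_contra h0
  exact hv (hx.2.singleton_mem (Finsupp.mem_support_iff.mpr h0))

/-! ### Suspensions of subdivisions -/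

section Suspension

variable [DecidableEq V] {K : PreAbstractSimplicialComplex V} {a b : V}

theorem eq_single_add_single_add_erase (hab : a ≠ b) (x : V →₀ ℝ) :
    x = Finsupp.single a (x a) + Finsupp.single b (x b) + (x.erase a).erase b := by
  ext w
  simp only [Finsupp.add_apply, Finsupp.single_apply, Finsupp.erase_apply]
  by_cases h1 : w = a
  · subst h1; simp [hab, hab.symm]
  · by_cases h2 : w = b
    · subst h2; simp [hab]
    · simp [h1, h2, Ne.symm h1, Ne.symm h2]

theorem mem_cone_of_mem_cone_suspension (ha : {a} ∉ K) (hb : {b} ∉ K)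
    {x : V →₀ ℝ} (hx : x ∈ (K.suspension a b).cone) :
    (x.erase a).erase b ∈ K.cone ∧ (x a = 0 ∨ x b = 0) := by
  obtain ⟨h1, h2⟩ := (isSimplex_suspension ha hb).mp hx.2
  refine ⟨⟨fun w => ?_, ?_⟩, ?_⟩
  · rw [Finsupp.erase_apply, Finsupp.erase_apply]
    split_ifs
    exacts [le_rfl, le_rfl, hx.1 w]
  · rwa [Finsupp.support_erase, Finsupp.support_erase]
  · simp only [Finsupp.mem_support_iff] at h2
    tauto

theorem add_mem_cone_suspension (hab : a ≠ b) (ha : {a} ∉ K) (hb : {b} ∉ K) {r s : ℝ}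
    {z : V →₀ ℝ} (hr : 0 ≤ r) (hs : 0 ≤ s) (hrs : r = 0 ∨ s = 0) (hz : z ∈ K.cone) :
    Finsupp.single a r + Finsupp.single b s + z ∈ (K.suspension a b).cone := by
  have hza := apply_eq_zero_of_mem_cone ha hz
  have hzb := apply_eq_zero_of_mem_cone hb hz
  refine ⟨fun v => ?_, (isSimplex_suspension ha hb).mpr ⟨hz.2.mono fun v hv => ?_, ?_⟩⟩
  · have := hz.1 v
    simp only [Finsupp.add_apply, Finsupp.single_apply]
    split_ifs <;> linarith
  · simp only [Finset.mem_erase, Finsupp.mem_support_iff, Finsupp.add_apply,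
      Finsupp.single_apply] at hv
    simpa [Ne.symm hv.1, Ne.symm hv.2.1] using hv.2.2
  · rcases hrs with rfl | rfl
    · simp [hza, hab.symm]
    · simp [hzb, hab]

/-- The suspension of a subdivision is a subdivision of the suspension. -/
theorem IsConeSubdivision.suspension [DecidableEq W]
    {M : PreAbstractSimplicialComplex W} {p : W → V →₀ ℝ}
    (h : IsConeSubdivision p M K) (hab : a ≠ b) (ha : {a} ∉ K) (hb : {b} ∉ K)
    {a' b' : W} (hab' : a' ≠ b') (ha' : {a'} ∉ M) (hb' : {b'} ∉ M) :
    IsConeSubdivision (fun w => if w = a' then Finsupp.single a 1 else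
      if w = b' then Finsupp.single b 1 else p w) (M.suspension a' b') (K.suspension a b) := by
  set q : W → V →₀ ℝ := fun w => if w = a' then Finsupp.single a 1 else
      if w = b' then Finsupp.single b 1 else p w with hq
  have hqa : q a' = Finsupp.single a 1 := if_pos rfl
  have hqb : q b' = Finsupp.single b 1 := by rw [hq]; simp [hab'.symm]
  have hqp : ∀ w, w ≠ a' → w ≠ b' → q w = p w := fun w h1 h2 => by rw [hq]; simp [h1, h2]
  have happ : ∀ (r s : ℝ) (z : W →₀ ℝ), z ∈ M.cone → Finsupp.linearCombination ℝ q
      (Finsupp.single a' r + Finsupp.single b' s + z) =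
      Finsupp.single a r + Finsupp.single b s + Finsupp.linearCombination ℝ p z := by
    intro r s z hz
    rw [map_add, map_add, Finsupp.linearCombination_single, Finsupp.linearCombination_single,
      hqa, hqb, Finsupp.smul_single_one, Finsupp.smul_single_one,
      linearCombination_congr (p := q) (q := p) (x := z)]
    intro w hw
    exact hqp w (fun h => ha' (hz.2.singleton_mem (h ▸ hw)))
      (fun h => hb' (hz.2.singleton_mem (h ▸ hw)))
  have hE : ∀ {x : W →₀ ℝ}, x ∈ (M.suspension a' b').cone →
      (x.erase a').erase b' ∈ M.cone ∧ (x a' = 0 ∨ x b' = 0) :=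
    mem_cone_of_mem_cone_suspension ha' hb'
  refine ⟨fun τ hτ => ?_, fun x hx => ?_, fun x hx y hy hxy => ?_, fun u hu => ?_⟩
  · have hτ' := (isSimplex_suspension ha' hb').mp (Or.inr hτ)
    obtain ⟨ρ, hρ, hρτ⟩ : ∃ ρ, K.IsSimplex ρ ∧ ∀ w ∈ (τ.erase a').erase b', (p w).support ⊆ ρ := by
      rcases hτ'.1 with h0 | h1
      · exact ⟨∅, Or.inl rfl, by simp [h0]⟩
      · obtain ⟨ρ, hρ, hs⟩ := h.carrier _ h1
        exact ⟨ρ, Or.inr hρ, hs⟩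
    have haρ : a ∉ ρ := fun h => ha (hρ.singleton_mem h)
    have hbρ : b ∉ ρ := fun h => hb (hρ.singleton_mem h)
    -- If `τ` contains neither apex, `a` is still put into `A`; either choice would do.
    have key : ∃ A : Finset V, (K.suspension a b).IsSimplex (A ∪ ρ) ∧
        (a' ∈ τ → a ∈ A) ∧ (b' ∈ τ → b ∈ A) ∧ A.Nonempty := by
      by_cases hbτ : b' ∈ τ
      · refine ⟨{b}, (isSimplex_suspension ha hb).mpr ⟨hρ.mono ?_, ?_⟩, fun h1 =>
          absurd ⟨h1, hbτ⟩ hτ'.2, fun _ => by simp, by simp⟩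
        · intro x hx
          simp only [Finset.mem_erase, Finset.mem_union, Finset.mem_singleton] at hx
          tauto
        · simp [haρ, hab]
      · refine ⟨{a}, (isSimplex_suspension ha hb).mpr ⟨hρ.mono ?_, ?_⟩, fun _ => by simp,
          fun h1 => absurd h1 hbτ, by simp⟩
        · intro x hx
          simp only [Finset.mem_erase, Finset.mem_union, Finset.mem_singleton] at hx
          tauto
        · simp [hbρ, hab.symm]
    obtain ⟨A, hA, hAa, hAb, hAne⟩ := key
    refine ⟨A ∪ ρ, hA.mem (hAne.mono Finset.subset_union_left), fun w hw => ?_⟩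
    by_cases h1 : w = a'
    · subst h1
      rw [hqa]
      exact Finsupp.support_single_subset.trans (by simp [hAa hw])
    · by_cases h2 : w = b'
      · subst h2
        rw [hqb]
        exact Finsupp.support_single_subset.trans (by simp [hAb hw])
      · rw [hqp w h1 h2]
        exact (hρτ w (by simp [h1, h2, hw])).trans Finset.subset_union_right
  · rw [eq_single_add_single_add_erase hab' x, happ _ _ _ (hE hx).1]
    exact add_mem_cone_suspension hab ha hb (hx.1 _) (hx.1 _) (hE hx).2
      (h.bijOn.mapsTo (hE hx).1)
  · rw [eq_single_add_single_add_erase hab' x, eq_single_add_single_add_erase hab' y,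
      happ _ _ _ (hE hx).1, happ _ _ _ (hE hy).1] at hxy
    have hx' := h.bijOn.mapsTo (hE hx).1
    have hy' := h.bijOn.mapsTo (hE hy).1
    have ea : x a' = y a' := by
      have := DFunLike.congr_fun hxy a
      simpa [Finsupp.single_apply, hab.symm, apply_eq_zero_of_mem_cone ha hx',
        apply_eq_zero_of_mem_cone ha hy'] using this
    have eb : x b' = y b' := by
      have := DFunLike.congr_fun hxy b
      simpa [Finsupp.single_apply, hab, apply_eq_zero_of_mem_cone hb hx',
        apply_eq_zero_of_mem_cone hb hy'] using this
    rw [ea, eb] at hxy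
    rw [eq_single_add_single_add_erase hab' x, eq_single_add_single_add_erase hab' y, ea, eb,
      h.bijOn.injOn (hE hx).1 (hE hy).1 (add_left_cancel hxy)]
  · obtain ⟨hu1, hu2⟩ := mem_cone_of_mem_cone_suspension ha hb hu
    obtain ⟨z, hz, hzu⟩ := h.bijOn.surjOn hu1
    refine ⟨Finsupp.single a' (u a) + Finsupp.single b' (u b) + z,
      add_mem_cone_suspension hab' ha' hb' (hu.1 _) (hu.1 _) hu2 hz, ?_⟩
    rw [happ _ _ _ hz, hzu, ← eq_single_add_single_add_erase hab u]

end Suspension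

/-! ### Links of vertices in subdivisions -/

section Link

variable {M : PreAbstractSimplicialComplex W} {K : PreAbstractSimplicialComplex V}
  {p : W → V →₀ ℝ}

/-- A vertex of `K` spans an extreme ray of the cone: by nonnegativity, every vertex of `M` used to
represent it must lie on that ray. -/
theorem IsConeSubdivision.exists_vertex_over (h : IsConeSubdivision p M K) {v : V} (hv : {v} ∈ K) :
    ∃ w, {w} ∈ M ∧ ∃ c : ℝ, 0 < c ∧ p w = Finsupp.single v c := by
  obtain ⟨x, hx, hxv⟩ := h.bijOn.surjOn (single_mem_cone hv zero_le_one)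
  have hx0 : x ≠ 0 := by
    rintro rfl
    rw [map_zero] at hxv
    exact one_ne_zero (Finsupp.single_eq_zero.mp hxv.symm)
  obtain ⟨w, hw⟩ := Finsupp.support_nonempty_iff.mpr hx0
  have hwM := hx.2.singleton_mem hw
  have hsub : (p w).support ⊆ {v} := by
    intro u hu
    have := mem_support_linearCombination hx.1
      (fun w hw => (h.vertex_mem_cone (hx.2.singleton_mem hw)).1) hw hu
    rw [hxv] at this
    exact Finsupp.support_single_subset this
  have heq : p w = Finsupp.single v (p w v) := (Finsupp.support_subset_singleton.mp hsub)
  refine ⟨w, hwM, p w v, lt_of_le_of_ne ((h.vertex_mem_cone hwM).1 v) fun h0 => ?_, heq⟩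
  rw [← h0, Finsupp.single_zero] at heq
  exact h.vertex_ne_zero hwM heq

theorem linearCombination_erase (p : W → V →₀ ℝ) (v : V) (x : W →₀ ℝ) :
    Finsupp.linearCombination ℝ (fun w => (p w).erase v) x =
      (Finsupp.linearCombination ℝ p x).erase v := by
  classical
  ext u
  rw [linearCombination_apply_apply, Finsupp.erase_apply, linearCombination_apply_apply]
  split_ifs with h
  · subst h; simp
  · exact Finset.sum_congr rfl fun w _ => by rw [Finsupp.erase_ne h]

variable [DecidableEq V] [DecidableEq W]

/-- Far enough along a ray in the direction of a vertex `v`, the simplices of a finite subdivision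
contain the vertex over `v`. -/
theorem IsConeSubdivision.exists_mem_support (h : IsConeSubdivision p M K)
    (hM : M.faces.Finite) {w₀ : W} {v : V} {c : ℝ} (hw₀ : {w₀} ∈ M) (hc : 0 < c)
    (hp : p w₀ = Finsupp.single v c) {u : V →₀ ℝ}
    (hu : ∀ n : ℕ, u + Finsupp.single v (n : ℝ) ∈ K.cone) :
    ∃ (n : ℕ), ∃ x ∈ M.cone,
      Finsupp.linearCombination ℝ p x = u + Finsupp.single v (n : ℝ) ∧ w₀ ∈ x.support := by
  choose x hx hxu using fun n => h.bijOn.surjOn (hu n)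
  have hfin : Finite {s : Finset W // s = ∅ ∨ s ∈ M.faces} := by
    have : {s : Finset W | s = ∅ ∨ s ∈ M.faces} = insert ∅ M.faces := rfl
    exact (this ▸ hM.insert ∅ : {s : Finset W | s = ∅ ∨ s ∈ M.faces}.Finite)
  -- Pigeonhole: `M` has finitely many simplices, so infinitely many points of the ray share the
  -- support `T`.
  obtain ⟨⟨T, hT⟩, hinf⟩ := Finite.exists_infinite_fiber
    (fun n => (⟨(x n).support, (hx n).2⟩ : {s : Finset W // s = ∅ ∨ s ∈ M.faces}))
  set S : Set ℕ := {n | (x n).support = T} with hS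
  have hinf' : S.Infinite := by
    refine Set.infinite_coe_iff.mp ?_
    convert hinf using 3
    ext n
    exact ⟨fun h => Subtype.ext h, fun h => congrArg Subtype.val h⟩
  obtain ⟨n₀, hn₀⟩ := hinf'.nonempty
  obtain ⟨n₁, hn₁, hlt⟩ := hinf'.exists_gt n₀
  have hlt' : (n₀ : ℝ) < n₁ := by exact_mod_cast hlt
  have hTs : M.IsSimplex T := hT
  -- Inside the single simplex `T` the lift is affine in `n`, because both sides lie over the same
  -- point.
  have hid : ∀ n ∈ S, n₁ < n → ((n : ℝ) - n₁) • x n₀ + ((n₁ : ℝ) - n₀) • x n =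
      ((n : ℝ) - n₀) • x n₁ := by
    intro n hn hgt
    have hgt' : (n₁ : ℝ) < n := by exact_mod_cast hgt
    refine h.bijOn.injOn (mem_cone_of_support_subset hTs (fun w => ?_) ?_)
      (smul_mem_cone (hx n₁) (by linarith)) ?_
    · exact add_nonneg (mul_nonneg (by linarith) ((hx n₀).1 w))
        (mul_nonneg (by linarith) ((hx n).1 w))
    · refine Finsupp.support_add.trans (Finset.union_subset ?_ ?_)
      · exact Finsupp.support_smul.trans hn₀.subset
      · exact Finsupp.support_smul.trans (Eq.subset hn)
    · rw [map_add, map_smul, map_smul, map_smul, hxu, hxu, hxu]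
      ext a
      simp only [Finsupp.add_apply, Finsupp.smul_apply, Finsupp.single_apply, smul_eq_mul]
      split_ifs <;> ring
  -- A coordinate that decreases from `n₀` to `n₁` would, being affine in `n`, become negative for
  -- large `n`.
  have hD : ∀ w, 0 ≤ (x n₁ - x n₀) w := by
    intro w
    rw [Finsupp.sub_apply]
    by_contra hneg
    push Not at hneg
    set a₀ := x n₀ w
    set a₁ := x n₁ w
    obtain ⟨N, hN⟩ := exists_nat_gt ((n₁ * a₀ - n₀ * a₁) / (a₀ - a₁))
    obtain ⟨n, hn, hgt⟩ := hinf'.exists_gt (max N n₁)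
    have h1 : N < n := (le_max_left _ _).trans_lt hgt
    have h2 : n₁ < n := (le_max_right _ _).trans_lt hgt
    have h1' : (N : ℝ) < n := by exact_mod_cast h1
    have h3 := DFunLike.congr_fun (hid n hn h2) w
    simp only [Finsupp.add_apply, Finsupp.smul_apply, smul_eq_mul] at h3
    have h4 := (hx n).1 w
    rw [div_lt_iff₀ (by linarith)] at hN
    have h5 : (N : ℝ) * (a₀ - a₁) < n * (a₀ - a₁) := mul_lt_mul_of_pos_right h1' (by linarith)
    have h6 : 0 ≤ ((n₁ : ℝ) - n₀) * x n w := mul_nonneg (by linarith) h4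
    linarith
  -- The difference is a point of the cone lying over a multiple of `v`, so it is a multiple of
  -- `w₀`; the multiple is positive, which puts `w₀` in the support of `x n₁`.
  have hDc : x n₁ - x n₀ = Finsupp.single w₀ (((n₁ : ℝ) - n₀) / c) := by
    refine h.bijOn.injOn (mem_cone_of_support_subset hTs hD ?_)
      (single_mem_cone hw₀ (div_nonneg (by linarith) hc.le)) ?_
    · exact Finsupp.support_sub.trans (Finset.union_subset (Eq.subset hn₁) (Eq.subset hn₀))
    · rw [map_sub, hxu, hxu, Finsupp.linearCombination_single, hp, Finsupp.smul_single, smul_eq_mul,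
        div_mul_cancel₀ _ hc.ne', Finsupp.single_sub]
      abel
  refine ⟨n₁, x n₁, hx n₁, hxu n₁, ?_⟩
  have := DFunLike.congr_fun hDc w₀
  rw [Finsupp.sub_apply, Finsupp.single_eq_same] at this
  have h1 : 0 < ((n₁ : ℝ) - n₀) / c := div_pos (by linarith) hc
  have h2 := (hx n₀).1 w₀
  rw [Finsupp.mem_support_iff]
  linarith

/-- The link of a vertex in a subdivision is a subdivision of the link of the vertex. -/
theorem IsConeSubdivision.link (h : IsConeSubdivision p M K) (hM : M.faces.Finite) {w₀ : W}
    {v : V} {c : ℝ} (hw₀ : {w₀} ∈ M) (hc : 0 < c) (hp : p w₀ = Finsupp.single v c) :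
    IsConeSubdivision (fun w => (p w).erase v) (M.link {w₀}) (K.link {v}) := by
  have hpsupp : (p w₀).support = {v} := by
    rw [hp]; simp [hc.ne']
  have hv : {v} ∈ K := (h.vertex_mem_cone hw₀).2.singleton_mem (by rw [hpsupp]; simp)
  -- Only `w₀` lies over the ray of `v`, so forgetting the coordinate `v` kills no other vertex.
  have hinj : ∀ w, {w} ∈ M → w ≠ w₀ → ∃ u ∈ (p w).support, u ≠ v := by
    intro w hw hne
    by_contra! hall
    have hpw := Finsupp.support_subset_singleton.mp
      (fun u hu => Finset.mem_singleton.mpr (hall u hu) : (p w).support ⊆ {v})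
    have := h.bijOn.injOn (single_mem_cone hw hc.le)
      (single_mem_cone hw₀ ((h.vertex_mem_cone hw).1 v)) (by
        rw [Finsupp.linearCombination_single, Finsupp.linearCombination_single, hp, hpw,
          Finsupp.smul_single, Finsupp.smul_single, Finsupp.single_eq_same, smul_eq_mul,
          smul_eq_mul, mul_comm])
    have := DFunLike.congr_fun this w
    rw [Finsupp.single_eq_same, Finsupp.single_eq_of_ne hne] at this
    exact hc.ne' this
  have hlink : ∀ {τ}, (M.link {w₀}).IsSimplex τ ↔ M.IsSimplex (insert w₀ τ) ∧ w₀ ∉ τ :=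
    isSimplex_link_singleton hw₀
  have hlink' : ∀ {τ}, (K.link {v}).IsSimplex τ ↔ K.IsSimplex (insert v τ) ∧ v ∉ τ :=
    isSimplex_link_singleton hv
  have hcar : ∀ τ ∈ M.link {w₀}, ∃ σ ∈ K.link {v}, ∀ w ∈ τ, ((p w).erase v).support ⊆ σ := by
    intro τ hτ
    obtain ⟨h1, h2⟩ := hlink.mp (Or.inr hτ)
    obtain ⟨σ, hσ, hs⟩ := h.carrier _ (h1.mem (Finset.insert_nonempty _ _))
    have hvσ : v ∈ σ := hs w₀ (Finset.mem_insert_self _ _) (by rw [hpsupp]; simp)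
    have herase : ∀ w ∈ τ, ((p w).erase v).support ⊆ σ.erase v := by
      intro w hw
      rw [Finsupp.support_erase]
      exact Finset.erase_subset_erase _ (hs w (Finset.mem_insert_of_mem hw))
    refine ⟨σ.erase v, IsSimplex.mem (hlink'.mpr ⟨?_, by simp⟩) ?_, herase⟩
    · rw [Finset.insert_erase hvσ]; exact Or.inr hσ
    · obtain ⟨w, hw⟩ := nonempty_of_mem hτ
      obtain ⟨u, hu, huv⟩ := hinj w (h1.singleton_mem (Finset.mem_insert_of_mem hw))
        (ne_of_mem_of_not_mem hw h2)
      exact ⟨u, Finset.mem_erase.mpr ⟨huv, hs w (Finset.mem_insert_of_mem hw) hu⟩⟩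
  have hsubM : ∀ {x}, x ∈ (M.link {w₀}).cone → x ∈ M.cone := fun hx =>
    ⟨hx.1, (hlink.mp hx.2).1.mono (Finset.subset_insert _ _)⟩
  have hw₀x : ∀ {x}, x ∈ (M.link {w₀}).cone → x w₀ = 0 := fun hx =>
    Finsupp.notMem_support_iff.mp (hlink.mp hx.2).2
  have hplus : ∀ {x} {t : ℝ}, x ∈ (M.link {w₀}).cone → 0 ≤ t →
      x + Finsupp.single w₀ t ∈ M.cone := by
    intro x t hx ht
    refine mem_cone_of_support_subset (hlink.mp hx.2).1 (fun w => ?_) ?_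
    · have := hx.1 w
      rw [Finsupp.add_apply, Finsupp.single_apply]
      split_ifs <;> linarith
    · refine Finsupp.support_add.trans (Finset.union_subset (Finset.subset_insert _ _) ?_)
      exact Finsupp.support_single_subset.trans (by simp)
  -- If two images differ only in the coordinate `v`, adding a multiple `t` of `w₀` to one point
  -- makes the images equal. Points of the link have no `w₀`-coordinate, so `t = 0`.
  have hone : ∀ x ∈ (M.link {w₀}).cone, ∀ y ∈ (M.link {w₀}).cone,
      (Finsupp.linearCombination ℝ p x).erase v = (Finsupp.linearCombination ℝ p y).erase v →
      Finsupp.linearCombination ℝ p y v ≤ Finsupp.linearCombination ℝ p x v → x = y := by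
    intro x hx y hy hxy hle
    set t := (Finsupp.linearCombination ℝ p x v - Finsupp.linearCombination ℝ p y v) / c with ht
    have ht0 : 0 ≤ t := div_nonneg (by linarith) hc.le
    have := h.bijOn.injOn (hsubM hx) (hplus hy ht0) (by
      rw [map_add, Finsupp.linearCombination_single, hp, Finsupp.smul_single, smul_eq_mul, ht,
        div_mul_cancel₀ _ hc.ne']
      ext u
      rw [Finsupp.add_apply, Finsupp.single_apply]
      split_ifs with h
      · subst h; ring
      · have := DFunLike.congr_fun hxy u
        rwa [Finsupp.erase_ne (Ne.symm h), Finsupp.erase_ne (Ne.symm h), ← add_zero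
          (Finsupp.linearCombination ℝ p y u)] at this)
    have ht0' : t = 0 := by
      have := DFunLike.congr_fun this w₀
      rw [Finsupp.add_apply, hw₀x hx, hw₀x hy, Finsupp.single_eq_same, zero_add] at this
      exact this.symm
    rwa [ht0', Finsupp.single_zero, add_zero] at this
  refine ⟨hcar, mapsTo_cone hcar fun w hw u => ?_, fun x hx y hy hxy => ?_, fun u hu => ?_⟩
  · have hwM : {w} ∈ M := ((hlink.mp (Or.inr hw)).1).singleton_mem (by simp)
    rw [Finsupp.erase_apply]
    split_ifs
    exacts [le_rfl, (h.vertex_mem_cone hwM).1 u]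
  · rw [linearCombination_erase, linearCombination_erase] at hxy
    rcases le_total (Finsupp.linearCombination ℝ p y v) (Finsupp.linearCombination ℝ p x v)
      with hle | hle
    · exact hone x hx y hy hxy hle
    · exact (hone y hy x hx hxy.symm hle).symm
  · obtain ⟨hu1, hu2⟩ := hlink'.mp hu.2
    -- Far out in the direction of `v` the lift meets the star of `w₀`; erasing `w₀` then gives a
    -- point of the link with the required image.
    obtain ⟨n, x, hx, hxu, hw⟩ := h.exists_mem_support hM hw₀ hc hp (u := u) (fun n => by
      refine mem_cone_of_support_subset hu1 (fun a => ?_) ?_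
      · have := hu.1 a
        rw [Finsupp.add_apply, Finsupp.single_apply]
        split_ifs
        · positivity
        · linarith
      · refine Finsupp.support_add.trans (Finset.union_subset (Finset.subset_insert _ _) ?_)
        exact Finsupp.support_single_subset.trans (by simp))
    refine ⟨x.erase w₀, ⟨fun a => ?_, hlink.mpr ⟨?_, ?_⟩⟩, ?_⟩
    · rw [Finsupp.erase_apply]
      split_ifs
      exacts [le_rfl, hx.1 a]
    · rw [Finsupp.support_erase, Finset.insert_erase hw]
      exact hx.2
    · simp
    · rw [linearCombination_erase]
      have h1 : x.erase w₀ = x - Finsupp.single w₀ (x w₀) :=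
        eq_sub_of_add_eq (Finsupp.erase_add_single w₀ x)
      rw [h1, map_sub, hxu, Finsupp.linearCombination_single, hp, Finsupp.smul_single]
      ext a
      rw [Finsupp.erase_apply]
      split_ifs with ha
      · rw [ha, Finsupp.notMem_support_iff.mp hu2]
      · simp [ha]

end Link

/-! ### Finiteness and fresh names -/

section Finite

theorem finite_of_vertices_subset {K : PreAbstractSimplicialComplex V} {S : Set V} (hS : S.Finite)
    (h : ∀ v, {v} ∈ K → v ∈ S) : K.faces.Finite :=
  (hS.finite_subsets.preimage Finset.coe_injective.injOn).subset fun _ ht v hv =>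
    h v (IsSimplex.singleton_mem (Or.inr ht) hv)

theorem IsConeSubdivision.finite {M : PreAbstractSimplicialComplex W}
    {K : PreAbstractSimplicialComplex V} {p : W → V →₀ ℝ} (h : IsConeSubdivision p M K)
    (hM : M.faces.Finite) : K.faces.Finite := by
  refine finite_of_vertices_subset (S := ⋃ w ∈ {w | {w} ∈ M}, ((p w).support : Set V))
    ((finite_vertices hM).biUnion fun w _ => (p w).support.finite_toSet) fun v hv => ?_
  obtain ⟨w, hw, c, hc, hp⟩ := h.exists_vertex_over hv
  exact Set.mem_biUnion hw (by simp [hp, hc.ne'])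

theorem exists_two_notMem [Infinite V] {K : PreAbstractSimplicialComplex V}
    (hK : K.faces.Finite) : ∃ a b, a ≠ b ∧ {a} ∉ K ∧ {b} ∉ K := by
  obtain ⟨a, ha⟩ := (finite_vertices hK).infinite_compl.nonempty
  obtain ⟨b, hb⟩ := ((finite_vertices hK).insert a).infinite_compl.nonempty
  simp only [Set.mem_compl_iff, Set.mem_insert_iff, Set.mem_ofPred_eq, not_or] at ha hb
  exact ⟨a, b, Ne.symm hb.1, ha, hb.2⟩

theorem finite_stellar [DecidableEq V] {K : PreAbstractSimplicialComplex V} {σ : Finset V} {w : V}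
    (hK : K.faces.Finite) (hσ : σ ∈ K) (hw : {w} ∉ K) : (K.stellar σ w).faces.Finite := by
  refine finite_of_vertices_subset ((finite_vertices hK).insert w) fun v hv => ?_
  have := ((isSimplex_stellar hσ hw).mp (Or.inr hv)).1
  by_cases h : v = w
  · exact Or.inl h
  · exact Or.inr (this.singleton_mem (by simp [h]))

theorem finite_suspension [DecidableEq V] {K : PreAbstractSimplicialComplex V} {a b : V}
    (hK : K.faces.Finite) (ha : {a} ∉ K) (hb : {b} ∉ K) : (K.suspension a b).faces.Finite := by
  refine finite_of_vertices_subset (((finite_vertices hK).insert b).insert a) fun v hv => ?_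
  have := ((isSimplex_suspension ha hb).mp (Or.inr hv)).1
  by_cases h : v = a
  · exact Or.inl h
  by_cases h' : v = b
  · exact Or.inr (Or.inl h')
  · exact Or.inr (Or.inr (this.singleton_mem (by simp [h, h'])))

theorem finite_link [DecidableEq V] {K : PreAbstractSimplicialComplex V} {σ : Finset V}
    (hK : K.faces.Finite) : (K.link σ).faces.Finite :=
  hK.subset fun _ h => h.1

end Finite

theorem isSimplex_map_of_leftInv [DecidableEq V] [DecidableEq W]
    {M : PreAbstractSimplicialComplex W} {f : W → V} {g : V → W} (hgf : Function.LeftInverse g f)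
    (hfg : Function.RightInverse g f) {s : Finset V} :
    (M.map f).IsSimplex s ↔ M.IsSimplex (s.image g) := by
  constructor
  · rintro (rfl | ⟨t, ht, rfl⟩)
    · exact Or.inl rfl
    · have ht : t ∈ M := ht
      have : (t.image f).image g = t := by rw [Finset.image_image, hgf.comp_eq_id, Finset.image_id]
      exact Or.inr (by change (t.image f).image g ∈ M; rwa [this])
  · rintro (h | h)
    · exact Or.inl (Finset.image_eq_empty.mp h)
    · exact Or.inr ⟨s.image g, h, by
        change (s.image g).image f = s
        rw [Finset.image_image, hfg.comp_eq_id, Finset.image_id]⟩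

/-! ### Boundaries of simplices and their joins -/

theorem boundary_map [DecidableEq V] (σ : Finset W) {f : W → V} (hf : Function.Injective f) :
    (boundary σ).map f = boundary (σ.image f) := by
  ext s
  constructor
  · rintro ⟨t, ⟨ht, hts⟩, rfl⟩
    exact ⟨ht.image f, (Finset.image_ssubset_image hf).mpr hts⟩
  · rintro ⟨hs, hsσ⟩
    obtain ⟨t, ht, rfl⟩ := Finset.subset_image_iff.mp hsσ.subset
    exact ⟨t, ⟨Finset.image_nonempty.mp hs, (Finset.image_ssubset_image hf).mp hsσ⟩, rfl⟩

theorem finite_boundary (σ : Finset V) : (boundary σ).faces.Finite :=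
  finite_of_vertices_subset σ.finite_toSet fun _ hv =>
    Finset.singleton_subset_iff.mp (hv.2.subset)

theorem isSimplex_join_boundary [DecidableEq V] {A B : Finset V} (hA : A.Nonempty)
    (hB : B.Nonempty) (hd : Disjoint A B) {s : Finset V} :
    ((boundary A).join (boundary B)).IsSimplex s ↔ s ⊆ A ∪ B ∧ ¬ A ⊆ s ∧ ¬ B ⊆ s := by
  simp only [isSimplex_join, isSimplex_boundary hA, isSimplex_boundary hB]
  constructor
  · rintro ⟨X, Y, hX, hY, rfl⟩
    refine ⟨Finset.union_subset_union hX.subset hY.subset, fun h => hX.2 fun x hx => ?_,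
      fun h => hY.2 fun x hx => ?_⟩
    · exact (Finset.mem_union.mp (h hx)).resolve_right
        fun hxY => Finset.disjoint_left.mp hd hx (hY.subset hxY)
    · exact (Finset.mem_union.mp (h hx)).resolve_left
        fun hxX => Finset.disjoint_left.mp hd (hX.subset hxX) hx
  · rintro ⟨h1, h2, h3⟩
    refine ⟨s ∩ A, s ∩ B, ⟨Finset.inter_subset_right, fun h => h2 (h.trans
      Finset.inter_subset_left)⟩, ⟨Finset.inter_subset_right, fun h => h3 (h.trans
      Finset.inter_subset_left)⟩, ?_⟩
    rw [← Finset.inter_union_distrib_left, Finset.inter_eq_left.mpr h1]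

/-- The simplices outside the star of `A` are those containing `B`. Together with the cone over `∂A
∗ ∂B` they form `∂A ∗ (B ∪ w ∗ ∂B)`, and the second factor is the boundary of the simplex on `B` and
`w`. -/
theorem stellar_boundary [DecidableEq V] {A B : Finset V} (hA : A.Nonempty) (hB : B.Nonempty)
    (hd : Disjoint A B) {w : V} (hw : w ∉ A ∪ B) :
    (boundary (A ∪ B)).stellar A w = (boundary A).join (boundary (insert w B)) := by
  have hwA : w ∉ A := fun h => hw (Finset.mem_union_left _ h)
  have hwB : w ∉ B := fun h => hw (Finset.mem_union_right _ h)
  obtain ⟨b, hb⟩ := hB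
  obtain ⟨a, ha⟩ := hA
  have hAm : A ∈ boundary (A ∪ B) := ⟨⟨a, ha⟩, Finset.subset_union_left, fun h =>
    Finset.disjoint_right.mp hd hb (h (Finset.mem_union_right _ hb))⟩
  have hwm : {w} ∉ boundary (A ∪ B) := fun h => hw (h.2.subset (Finset.mem_singleton_self w))
  refine ext_isSimplex fun s => ?_
  rw [isSimplex_stellar hAm hwm, isSimplex_join_boundary ⟨a, ha⟩ (Finset.insert_nonempty _ _)
    (Finset.disjoint_insert_right.mpr ⟨hwA, hd⟩),
    isSimplex_boundary ⟨a, Finset.mem_union_left _ ha⟩,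
    isSimplex_boundary ⟨a, Finset.mem_union_left _ ha⟩]
  constructor
  · rintro ⟨h1, h2, h3⟩
    refine ⟨fun x hx => ?_, h2, fun h => ?_⟩
    · by_cases hxw : x = w
      · simp [hxw]
      · have := h1.subset (Finset.mem_erase.mpr ⟨hxw, hx⟩)
        rw [Finset.mem_union] at this ⊢
        exact this.imp_right Finset.mem_insert_of_mem
    · refine (h3 (h (Finset.mem_insert_self _ _))).2 fun x hx => ?_
      rcases Finset.mem_union.mp hx with hx | hx
      · exact Finset.mem_union_right _ hx
      · exact Finset.mem_union_left _ (Finset.mem_erase.mpr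
          ⟨ne_of_mem_of_not_mem hx hwB, h (Finset.mem_insert_of_mem hx)⟩)
  · rintro ⟨h1, h2, h3⟩
    have h4 : s.erase w ⊆ A ∪ B := fun x hx => by
      have := h1 (Finset.mem_of_mem_erase hx)
      simp only [Finset.mem_union, Finset.mem_insert] at this ⊢
      have := Finset.ne_of_mem_erase hx
      tauto
    refine ⟨⟨h4, fun h => h2 ((Finset.subset_union_left.trans h).trans
      (Finset.erase_subset _ _))⟩, h2, fun hws => ⟨Finset.union_subset h4
      Finset.subset_union_left, fun h => h3 ?_⟩⟩
    refine Finset.insert_subset hws fun x hx => ?_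
    rcases Finset.mem_union.mp (h (Finset.mem_union_right _ hx)) with h' | h'
    · exact Finset.mem_of_mem_erase h'
    · exact absurd hx (Finset.disjoint_left.mp hd h')

/-! ### PL spheres and the operations that preserve them -/

theorem isPLSphere_iff {K : PreAbstractSimplicialComplex V} :
    K.IsPLSphere ↔ ∃ (n : ℕ) (M : PreAbstractSimplicialComplex ℕ) (p : ℕ → V →₀ ℝ)
      (q : ℕ → Fin (n + 1) →₀ ℝ), M.faces.Finite ∧ IsConeSubdivision p M K ∧
      IsConeSubdivision q M (boundary Finset.univ) := by
  constructor
  · rintro ⟨n, M, hM, hp, hq⟩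
    obtain ⟨p, hp⟩ := hp.exists_isConeSubdivision
    obtain ⟨q, hq⟩ := hq.exists_isConeSubdivision
    exact ⟨n, M, p, q, hM, hp, hq⟩
  · rintro ⟨n, M, p, q, hM, hp, hq⟩
    exact ⟨n, M, hM, hp.isSubdivision, hq.isSubdivision⟩

/-- `Fin (n + 1)` has no spare names; inside `ℕ` the model sphere leaves room for new vertices. -/
theorem IsPLSphere.exists_subset_nat {K : PreAbstractSimplicialComplex V} (h : K.IsPLSphere) :
    ∃ (C : Finset ℕ) (M : PreAbstractSimplicialComplex ℕ) (p : ℕ → V →₀ ℝ) (q : ℕ → ℕ →₀ ℝ),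
      C.Nonempty ∧ M.faces.Finite ∧ IsConeSubdivision p M K ∧
      IsConeSubdivision q M (boundary C) := by
  obtain ⟨n, M, p, q, hM, hp, hq⟩ := isPLSphere_iff.mp h
  have := hq.trans (IsConeSubdivision.map _ (Fin.val : Fin (n + 1) → ℕ) Fin.val_injective.injOn)
  rw [boundary_map _ Fin.val_injective] at this
  exact ⟨_, M, p, _, Finset.univ_nonempty.image _, hM, hp, this⟩

section Sphere

variable {M : PreAbstractSimplicialComplex W} {K : PreAbstractSimplicialComplex V}
  {p : W → V →₀ ℝ}

theorem IsPLSphere.finite (h : K.IsPLSphere) : K.faces.Finite := by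
  obtain ⟨n, M, p, q, hM, hp, hq⟩ := isPLSphere_iff.mp h
  exact hp.finite hM

theorem IsPLSphere.of_subdivision (h : IsConeSubdivision p M K) (hM : M.IsPLSphere) :
    K.IsPLSphere := by
  obtain ⟨n, N, r, q, hN, hr, hq⟩ := isPLSphere_iff.mp hM
  exact isPLSphere_iff.mpr ⟨n, N, _, q, hN, hr.trans h, hq⟩

/-- The subdivision of `K` shared with the simplex boundary need not refine `M`, so it is replaced
by its common refinement with `M`. -/
theorem IsPLSphere.subdivision (h : IsConeSubdivision p M K) (hM : M.faces.Finite)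
    (hK : K.IsPLSphere) : M.IsPLSphere := by
  obtain ⟨n, N, r, q, hN, hr, hq⟩ := isPLSphere_iff.mp hK
  obtain ⟨N', q₁, q₂, hN', h₁, h₂, -⟩ := exists_common_subdivision h hr hM hN
  exact isPLSphere_iff.mpr ⟨n, N', q₁, _, hN', h₁, h₂.trans hq⟩

theorem IsPLSphere.map [DecidableEq W] (hK : K.IsPLSphere) {f : V → W}
    (hf : Function.Injective f) : (K.map f).IsPLSphere :=
  .of_subdivision (IsConeSubdivision.map K f hf.injOn) hK

theorem isPLSphere_boundary_univ (n : ℕ) :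
    (boundary (Finset.univ : Finset (Fin (n + 1)))).IsPLSphere := by
  have := IsConeSubdivision.map_symm (M := boundary (Finset.univ : Finset (Fin (n + 1))))
    (f := Fin.val) (g := Fin.ofNat (n + 1)) fun w _ => by simp
  exact isPLSphere_iff.mpr ⟨n, _, _, _, (finite_boundary _).image _, this, this⟩

variable [DecidableEq V]

theorem isPLSphere_boundary {C : Finset V} (hC : C.Nonempty) : (boundary C).IsPLSphere := by
  obtain ⟨n, hn⟩ := Nat.exists_eq_succ_of_ne_zero (Finset.card_pos.mpr hC).ne'
  have e : Fin (n + 1) ≃ C := (Fin.castOrderIso hn.symm).toEquiv.trans C.equivFin.symm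
  have hinj : Function.Injective (fun i => (e i : V)) :=
    Subtype.val_injective.comp e.injective
  have := (isPLSphere_boundary_univ n).map hinj
  rw [boundary_map _ hinj] at this
  convert this
  ext x
  simp only [Finset.mem_image, Finset.mem_univ, true_and]
  constructor
  · exact fun hx => ⟨e.symm ⟨x, hx⟩, by simp⟩
  · rintro ⟨i, rfl⟩
    exact (e i).2

theorem IsConeSubdivision.exists_stellar {σ : Finset V} {w : V} (hσ : σ ∈ K) (hw : {w} ∉ K) :
    ∃ p, IsConeSubdivision p (K.stellar σ w) K := by
  refine ⟨_, .stellar hσ hw (y := Finsupp.onFinset σ (fun v => if v ∈ σ then 1 else 0) ?_) ?_ ?_⟩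
  · intro v hv
    by_contra h
    simp [h] at hv
  · intro v
    rw [Finsupp.onFinset_apply]
    split_ifs <;> simp
  · ext v
    simp

theorem IsPLSphere.stellar (hK : K.IsPLSphere) {σ : Finset V} {w : V} (hσ : σ ∈ K)
    (hw : {w} ∉ K) : (K.stellar σ w).IsPLSphere := by
  obtain ⟨p, hp⟩ := IsConeSubdivision.exists_stellar hσ hw
  exact .subdivision hp (finite_stellar hK.finite hσ hw) hK

/-- By `stellar_boundary`, removing one point `w` from `B` exhibits the join as a stellar
subdivision of the boundary of a single simplex. If `w` is the only point, the join is `∂A`. -/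
theorem isPLSphere_join_boundary {A B : Finset V} (hA : A.Nonempty) (hB : B.Nonempty)
    (hd : Disjoint A B) : ((boundary A).join (boundary B)).IsPLSphere := by
  obtain ⟨w, hw⟩ := id hB
  have hwA : w ∉ A := Finset.disjoint_right.mp hd hw
  rcases (B.erase w).eq_empty_or_nonempty with h | h
  · obtain rfl : B = {w} := by rw [← Finset.insert_erase hw, h, insert_empty_eq]
    convert isPLSphere_boundary hA using 1
    refine ext_isSimplex fun s => ?_
    rw [isSimplex_join_boundary hA hB hd, isSimplex_boundary hA, Finset.singleton_subset_iff]
    constructor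
    · rintro ⟨h1, h2, h3⟩
      refine ⟨fun x hx => ?_, h2⟩
      exact (Finset.mem_union.mp (h1 hx)).resolve_right
        fun h => h3 (Finset.mem_singleton.mp h ▸ hx)
    · exact fun h => ⟨h.subset.trans Finset.subset_union_left, h.2, fun hs => hwA (h.subset hs)⟩
  · have hd' : Disjoint A (B.erase w) := hd.mono_right (Finset.erase_subset _ _)
    have hwn : w ∉ A ∪ B.erase w := by simp [hwA]
    have hst := stellar_boundary hA h hd' hwn
    rw [Finset.insert_erase hw] at hst
    rw [← hst]
    obtain ⟨b, hb⟩ := h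
    refine (isPLSphere_boundary ⟨b, Finset.mem_union_right _ hb⟩).stellar ⟨hA,
      Finset.subset_union_left, fun h => ?_⟩ fun h => hwn (h.2.subset (by simp))
    exact Finset.disjoint_right.mp hd' hb (h (Finset.mem_union_right _ hb))

/-- The link of the new vertex is `∂ρ` joined with the old link of `ρ`, which in a simplex boundary
is the boundary of the complementary simplex. -/
theorem link_stellar_boundary {C ρ : Finset V} (hρ : ρ ∈ boundary C) {w : V} (hw : w ∉ C) :
    ((boundary C).stellar ρ w).link {w} = (boundary ρ).join (boundary (C \ ρ)) := by
  have hwm : {w} ∉ boundary C := fun h => hw (h.2.subset (by simp))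
  have hCn : C.Nonempty := hρ.1.mono hρ.2.subset
  have hwρ : w ∉ ρ := fun h => hw (hρ.2.subset h)
  have hn : (C \ ρ).Nonempty := Finset.sdiff_nonempty.mpr hρ.2.2
  have hst := @isSimplex_stellar _ _ _ _ _ hρ hwm
  have hwst : {w} ∈ (boundary C).stellar ρ w := by
    refine IsSimplex.mem (hst.mpr ⟨?_, fun h => ?_, fun _ => ?_⟩) (by simp)
    · exact Or.inl (by simp)
    · obtain ⟨x, hx⟩ := hρ.1
      exact hwρ (Finset.mem_singleton.mp (h hx) ▸ hx)
    · exact Or.inr (by simpa using hρ)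
  refine ext_isSimplex fun s => ?_
  rw [isSimplex_link_singleton hwst, hst, isSimplex_join_boundary hρ.1 hn Finset.disjoint_sdiff,
    Finset.union_sdiff_of_subset hρ.2.subset, isSimplex_boundary hCn, isSimplex_boundary hCn]
  have hsub : ρ ⊆ insert w s ↔ ρ ⊆ s := by rw [Finset.subset_insert_iff_of_notMem hwρ]
  rw [hsub]
  constructor
  · rintro ⟨⟨h1, h2, h3⟩, h4⟩
    rw [Finset.erase_insert h4] at h1 h3
    refine ⟨h1.subset, h2, fun h => (h3 (by simp)).2 fun x hx => ?_⟩
    by_cases hxρ : x ∈ ρ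
    · exact Finset.mem_union_right _ hxρ
    · exact Finset.mem_union_left _ (h (Finset.mem_sdiff.mpr ⟨hx, hxρ⟩))
  · rintro ⟨h1, h2, h3⟩
    have h4 : w ∉ s := fun h => hw (h1 h)
    rw [Finset.erase_insert h4]
    refine ⟨⟨⟨h1, fun h => h2 (hρ.2.subset.trans h)⟩, h2, fun _ =>
      ⟨Finset.union_subset h1 hρ.2.subset, fun h => h3 fun x hx => ?_⟩⟩, h4⟩
    obtain ⟨hx1, hx2⟩ := Finset.mem_sdiff.mp hx
    exact (Finset.mem_union.mp (h hx1)).resolve_right hx2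

/-- The link of a vertex in a PL sphere is a PL sphere. -/
theorem IsPLSphere.link (hK : K.IsPLSphere) {v : V} (hv : {v} ∈ K) :
    (K.link {v}).IsPLSphere := by
  obtain ⟨C, M, p, q, hC, hM, hp, hq⟩ := hK.exists_subset_nat
  obtain ⟨w₀, hw₀, c, hc, hpw⟩ := hp.exists_vertex_over hv
  have hy := hq.vertex_mem_cone hw₀
  -- The vertex over `v` need not be a vertex of the model sphere. It lies in the interior of the
  -- face `ρ`, and a stellar subdivision there, with the new vertex placed at `q w₀`, makes it one.
  have hρ : (q w₀).support ∈ boundary C :=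
    hy.2.mem (Finsupp.support_nonempty_iff.mpr (hq.vertex_ne_zero hw₀))
  obtain ⟨w, hw⟩ := Infinite.exists_notMem_finset C
  have hwC : {w} ∉ boundary C := fun h => hw (h.2.subset (by simp))
  have hN := IsConeSubdivision.stellar hρ hwC hy.1 rfl
  have hNfin := finite_stellar (finite_boundary C) hρ hwC
  obtain ⟨M', q₁, q₂, hM', h₁, h₂, hcomp⟩ := exists_common_subdivision hq hN hM hNfin
  obtain ⟨w₁, hw₁, d, hd, hqw⟩ := h₁.exists_vertex_over hw₀
  have hst := @isSimplex_stellar _ _ _ _ _ hρ hwC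
  have hwst : {w} ∈ (boundary C).stellar (q w₀).support w := by
    refine IsSimplex.mem (hst.mpr ⟨Or.inl (by simp), fun h => ?_, fun _ => ?_⟩) (by simp)
    · obtain ⟨x, hx⟩ := hρ.1
      exact hw (Finset.mem_singleton.mp (h hx) ▸ hρ.2.subset hx)
    · exact Or.inr (by simpa using hρ)
  -- The vertex `w₁` lies over `w₀` and over `w`, so its link subdivides both links; this connects
  -- the link of `v` with a join of two boundaries.
  have hqw₂ : q₂ w₁ = Finsupp.single w d := by
    refine hN.bijOn.injOn (h₂.vertex_mem_cone hw₁) (single_mem_cone hwst hd.le) ?_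
    rw [← hcomp w₁ hw₁, hqw, Finsupp.linearCombination_single, Finsupp.linearCombination_single,
      if_pos rfl]
  have l₁ := h₁.link hM' hw₁ hd hqw
  have l₂ := h₂.link hM' hw₁ hd hqw₂
  have l₃ := hp.link hM hw₀ hc hpw
  rw [link_stellar_boundary hρ hw] at l₂
  have hs := isPLSphere_join_boundary hρ.1 (Finset.sdiff_nonempty.mpr hρ.2.2)
    Finset.disjoint_sdiff
  exact ((hs.subdivision l₂ (finite_link hM')).of_subdivision l₁).of_subdivision l₃

/-- The subdivision common to `K` and the boundary of a simplex can be suspended on both sides, and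
the suspension of that boundary is a join of two boundaries. -/
theorem IsPLSphere.suspension (hK : K.IsPLSphere) {a b : V} (hab : a ≠ b) (ha : {a} ∉ K)
    (hb : {b} ∉ K) : (K.suspension a b).IsPLSphere := by
  obtain ⟨C, M, p, q, hC, hM, hp, hq⟩ := hK.exists_subset_nat
  obtain ⟨a', b', hab', ha', hb'⟩ := exists_two_notMem hM
  obtain ⟨a'', ha''⟩ := Infinite.exists_notMem_finset C
  obtain ⟨b'', hb''⟩ := Infinite.exists_notMem_finset (insert a'' C)
  rw [Finset.mem_insert, not_or] at hb''
  have ha''C : {a''} ∉ boundary C := fun h => ha'' (h.2.subset (by simp))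
  have hb''C : {b''} ∉ boundary C := fun h => hb''.2 (h.2.subset (by simp))
  have h₁ := hp.suspension hab ha hb hab' ha' hb'
  have h₂ := hq.suspension (Ne.symm hb''.1) ha''C hb''C hab' ha' hb'
  have hs : ((boundary C).suspension a'' b'').IsPLSphere :=
    isPLSphere_join_boundary (by simp) hC (by simp [ha'', hb''.2])
  exact (hs.subdivision h₂ (finite_suspension hM ha' hb')).of_subdivision h₁

/-- Subdividing the edge `I` of the wedge replaces `I ∗ lk(v)` by `w ∗ ∂I ∗ lk(v)`. Now `∂I` is a
common join factor, and the other factor is `K` with `w` in the place of `v`. -/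
theorem stellar_wedge {v v' w : V} (hv : {v} ∈ K) (hv' : {v'} ∉ K) (hw : {w} ∉ K)
    (hwv' : w ≠ v') : {v, v'} ∈ K.wedge v v' ∧ {w} ∉ K.wedge v v' ∧
      {v} ∉ K.map (Equiv.swap v w) ∧ {v'} ∉ K.map (Equiv.swap v w) ∧
      (K.wedge v v').stellar {v, v'} w = (K.map (Equiv.swap v w)).suspension v v' := by
  have hvv' : v ≠ v' := by rintro rfl; exact hv' hv
  have hwv : w ≠ v := by rintro rfl; exact hw hv
  have hI : {v, v'} ∈ K.wedge v v' := by
    refine IsSimplex.mem ((isSimplex_wedge hv hv').mpr ⟨Or.inl ?_, fun _ _ => Or.inr ?_⟩) (by simp)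
    · ext x; simp only [Finset.mem_erase, Finset.mem_insert, Finset.mem_singleton]; simp; tauto
    · convert hv using 1
      ext x
      simp only [Finset.mem_erase, Finset.mem_insert, Finset.mem_singleton]
      constructor
      · tauto
      · rintro rfl; exact ⟨hvv', Or.inl rfl⟩
  have hwW : {w} ∉ K.wedge v v' := by
    intro h
    have := ((isSimplex_wedge hv hv').mp (Or.inr h)).1
    exact hw (this.singleton_mem (by simp [hwv, hwv']))
  have hmap : ∀ {s}, (K.map (Equiv.swap v w)).IsSimplex s ↔
      K.IsSimplex (s.image (Equiv.swap v w)) :=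
    isSimplex_map_of_leftInv (g := Equiv.swap v w) (fun x => by simp) (fun x => by simp)
  have h3 : {v} ∉ K.map (Equiv.swap v w) := fun h => by
    have := hmap.mp (Or.inr h)
    exact hw (this.singleton_mem (by simp))
  have h4 : {v'} ∉ K.map (Equiv.swap v w) := fun h => by
    have := hmap.mp (Or.inr h)
    exact hv' (this.singleton_mem (by simp [Equiv.swap_apply_of_ne_of_ne hvv'.symm hwv'.symm]))
  refine ⟨hI, hwW, h3, h4, ext_isSimplex fun s => ?_⟩
  rw [isSimplex_stellar hI hwW, isSimplex_suspension h3 h4, hmap, isSimplex_wedge hv hv',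
    isSimplex_wedge hv hv']
  have hsub : ({v, v'} : Finset V) ⊆ s ↔ v ∈ s ∧ v' ∈ s := by
    simp [Finset.insert_subset_iff]
  rw [hsub]
  have himg : ((s.erase v).erase v').image (Equiv.swap v w) =
      if w ∈ s then insert v (((s.erase w).erase v).erase v') else ((s.erase w).erase v).erase v'
      := by
    ext x
    rw [Finset.mem_image]
    have : (∃ a ∈ (s.erase v).erase v', Equiv.swap v w a = x) ↔
        Equiv.swap v w x ∈ (s.erase v).erase v' :=
      ⟨by rintro ⟨a, ha, rfl⟩; simpa using ha, fun h => ⟨_, h, by simp⟩⟩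
    rw [this]
    by_cases hxv : x = v
    · subst hxv
      rw [Equiv.swap_apply_left]
      split_ifs with h <;> simp [h, hwv, hwv']
    · by_cases hxw : x = w
      · subst hxw
        rw [Equiv.swap_apply_right]
        split_ifs with h <;> simp [hwv]
      · rw [Equiv.swap_apply_of_ne_of_ne hxv hxw]
        split_ifs with h <;> simp [hxv, hxw]
  rw [himg]
  constructor
  · rintro ⟨⟨h1, -⟩, h2, h3⟩
    refine ⟨?_, h2⟩
    split_ifs with h
    · refine ((h3 h).2 (by simp) (by simp)).mono fun x hx => ?_
      simp only [Finset.mem_insert, Finset.mem_erase, Finset.mem_union,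
        Finset.mem_singleton] at hx ⊢
      rcases hx with rfl | hx
      · exact ⟨hvv', Or.inr (Or.inl rfl)⟩
      · tauto
    · exact h1
  · rintro ⟨h1, h2⟩
    have h5 : K.IsSimplex (((s.erase w).erase v).erase v') := by
      refine h1.mono ?_
      split_ifs
      · exact Finset.subset_insert _ _
      · exact subset_rfl
    refine ⟨⟨h5, fun h h' => absurd ⟨Finset.mem_of_mem_erase h, Finset.mem_of_mem_erase h'⟩ h2⟩,
      h2, fun h => ?_⟩
    rw [if_pos h] at h1
    refine ⟨h5.mono fun x hx => ?_, fun _ _ => h1.mono fun x hx => ?_⟩ <;>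
    · simp only [Finset.mem_insert, Finset.mem_erase, Finset.mem_union,
        Finset.mem_singleton] at hx ⊢
      tauto

/-- A stellar subdivision of the wedge is a suspension of a renamed `K`, hence a sphere. The name
`w` serves only as the new vertex of that subdivision. -/
theorem IsPLSphere.wedge (hK : K.IsPLSphere) {v v' w : V} (hv : {v} ∈ K) (hv' : {v'} ∉ K)
    (hw : {w} ∉ K) (hwv' : w ≠ v') : (K.wedge v v').IsPLSphere := by
  obtain ⟨hI, hwW, h1, h2, heq⟩ := stellar_wedge hv hv' hw hwv'
  obtain ⟨p, hp⟩ := IsConeSubdivision.exists_stellar hI hwW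
  refine .of_subdivision hp ?_
  rw [heq]
  exact (hK.map (Equiv.injective _)).suspension (by rintro rfl; exact hv' hv) h1 h2

end Sphere

/-! ### The complex `K(J)` -/

section IteratedWedge

variable [Fintype V] [DecidableEq V]

/-- The vertices all of whose copies are in `s`. -/
def fullVertices (J : V → ℕ) (s : Finset (V × ℕ)) : Finset V :=
  Finset.univ.filter fun v => ∀ i < J v, (v, i) ∈ s

theorem mem_fullVertices {J : V → ℕ} {s : Finset (V × ℕ)} {v : V} :
    v ∈ fullVertices J s ↔ ∀ i < J v, (v, i) ∈ s := by
  simp [fullVertices]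

/-- The full vertices form the largest set whose copies all lie in `s`, so they are the only set to
test. Positivity of `J` keeps vertices without copies from being full. -/
theorem isSimplex_iteratedWedge {K : PreAbstractSimplicialComplex V} {J : V → ℕ}
    (hJ : ∀ v, 1 ≤ J v) {s : Finset (V × ℕ)} :
    (K.iteratedWedge J).IsSimplex s ↔
      (∀ x ∈ s, x.2 < J x.1) ∧ K.IsSimplex (fullVertices J s) := by
  constructor
  · rintro (rfl | ⟨h1, h2, h3⟩)
    · refine ⟨by simp, Or.inl ?_⟩
      refine Finset.eq_empty_of_forall_notMem fun v hv => ?_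
      simpa using mem_fullVertices.mp hv 0 (hJ v)
    · refine ⟨h2, ?_⟩
      rcases (fullVertices J s).eq_empty_or_nonempty with h | h
      · exact Or.inl h
      · exact Or.inr (h3 _ h fun v hv => mem_fullVertices.mp hv)
  · rintro ⟨h1, h2⟩
    rcases s.eq_empty_or_nonempty with h | h
    · exact Or.inl h
    · exact Or.inr ⟨h, h1, fun t ht hc => (h2.mono fun v hv =>
        mem_fullVertices.mpr (hc v hv)).mem ht⟩

theorem singleton_mem_iteratedWedge (K : AbstractSimplicialComplex V) {J : V → ℕ}
    (hJ : ∀ v, 1 ≤ J v) {x : V × ℕ} : {x} ∈ K.iteratedWedge J ↔ x.2 < J x.1 := by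
  constructor
  · exact fun h => h.2.1 x (by simp)
  · intro h
    refine IsSimplex.mem ((isSimplex_iteratedWedge hJ).mpr ⟨by simpa using h, ?_⟩) (by simp)
    refine IsSimplex.mono (Or.inr (K.singleton_mem x.1)) fun v hv => ?_
    have := mem_fullVertices.mp hv 0 (hJ v)
    rw [Finset.mem_singleton] at this ⊢
    rw [← this]

/-- Removing one copy of a vertex with several copies undoes one wedge, so induction on the total
number of copies applies. -/
theorem isPLSphere_iteratedWedge (K : AbstractSimplicialComplex V)
    (hK : K.toPreAbstractSimplicialComplex.IsPLSphere) :
    ∀ (n : ℕ) (J : V → ℕ), (∀ v, 1 ≤ J v) → ∑ v, J v = n → (K.iteratedWedge J).IsPLSphere := by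
  intro n
  induction n with
  | zero =>
    intro J hJ hn
    -- A zero sum of positive entries means that there are no vertices, so the equality is vacuous.
    obtain rfl : J = fun _ => 1 := by
      funext v
      have := (Finset.sum_eq_zero_iff.mp hn) v (Finset.mem_univ v)
      have := hJ v
      omega
    rw [iteratedWedge_one]
    exact hK.map fun a b h => (Prod.ext_iff.mp h).1
  | succ n ih =>
    intro J hJ hn
    by_cases hone : ∀ v, J v = 1
    · obtain rfl : J = fun _ => 1 := funext hone
      rw [iteratedWedge_one]
      exact hK.map fun a b h => (Prod.ext_iff.mp h).1
    · push Not at hone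
      obtain ⟨v, hv⟩ := hone
      have hv1 := hJ v
      set J' := Function.update J v (J v - 1) with hJ'
      have hJ'v : J' v = J v - 1 := by simp [hJ']
      have hJ'1 : ∀ u, 1 ≤ J' u := by
        intro u
        by_cases hu : u = v
        · subst hu; omega
        · simpa [hJ', hu] using hJ u
      have hupd : Function.update J' v (J' v + 1) = J := by
        funext u
        by_cases hu : u = v
        · subst hu
          rw [Function.update_self]
          omega
        · simp [hJ', hu]
      have hsum : ∑ u, J' u = n := by
        have h1 : ∑ u, J' u = J v - 1 + ∑ u ∈ Finset.univ \ {v}, J u :=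
          Finset.sum_update_of_mem (Finset.mem_univ v) J (J v - 1)
        have h2 := Finset.add_sum_erase Finset.univ J (Finset.mem_univ v)
        rw [Finset.sdiff_singleton_eq_erase] at h1
        omega
      rw [← hupd, iteratedWedge_succ K J' hJ'1 v]
      refine (ih J' hJ'1 hsum).wedge (w := (v, J' v + 1)) ?_ ?_ ?_ ?_ <;>
        simp only [singleton_mem_iteratedWedge K hJ'1, ne_eq, Prod.mk.injEq]
      · exact hJ'1 v
      · omega
      · omega
      · omega

end IteratedWedge

theorem isSimplex_map_image [DecidableEq W] {K : PreAbstractSimplicialComplex V} {f : V → W}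
    (hf : Function.Injective f) {s : Finset V} :
    (K.map f).IsSimplex (s.image f) ↔ K.IsSimplex s := by
  constructor
  · rintro (h | ⟨t, ht, hts⟩)
    · exact Or.inl (Finset.image_eq_empty.mp h)
    · exact Or.inr (Finset.image_injective hf hts ▸ ht)
  · rintro (rfl | h)
    · exact Or.inl rfl
    · exact Or.inr ⟨s, h, rfl⟩

/-! ### Twins, wedges and suspensions -/

section Twin

variable [DecidableEq V] [DecidableEq W] {K : PreAbstractSimplicialComplex V}

/-- Two vertices are twins if every minimal non-face contains both or neither of them. -/
structure IsTwin (K : PreAbstractSimplicialComplex V) (a b : V) : Prop where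
  ne : a ≠ b
  left : ∀ τ, K.IsSimplex τ → b ∉ τ → K.IsSimplex (insert a τ)
  right : ∀ τ, K.IsSimplex τ → a ∉ τ → K.IsSimplex (insert b τ)

theorem IsTwin.symm {a b : V} (h : K.IsTwin a b) : K.IsTwin b a :=
  ⟨h.ne.symm, h.right, h.left⟩

theorem IsTwin.singleton_mem {a b : V} (h : K.IsTwin a b) : {a} ∈ K :=
  (h.left ∅ isSimplex_empty (by simp)).mem (by simp)

theorem isTwin_wedge {v v' : V} (hv : {v} ∈ K) (hv' : {v'} ∉ K) :
    (K.wedge v v').IsTwin v v' ∧ (K.wedge v v').IsSimplex {v, v'} := by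
  have hne : v ≠ v' := by rintro rfl; exact hv' hv
  refine ⟨⟨hne, fun τ hτ h => ?_, fun τ hτ h => ?_⟩, ?_⟩
  · rw [isSimplex_wedge hv hv'] at hτ ⊢
    refine ⟨hτ.1.mono fun x hx => ?_, fun _ h' => absurd h' (by simp [h, hne.symm])⟩
    simp only [Finset.mem_erase, Finset.mem_insert] at hx ⊢
    tauto
  · rw [isSimplex_wedge hv hv'] at hτ ⊢
    refine ⟨hτ.1.mono fun x hx => ?_, fun h' _ => absurd h' (by simp [h, hne])⟩
    simp only [Finset.mem_erase, Finset.mem_insert] at hx ⊢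
    tauto
  · rw [isSimplex_wedge hv hv']
    refine ⟨isSimplex_empty.mono fun x hx => ?_, fun _ _ => IsSimplex.mono (Or.inr hv)
      fun x hx => ?_⟩
    all_goals
      simp only [Finset.mem_erase, Finset.mem_insert, Finset.mem_singleton] at hx ⊢
      tauto

theorem isTwin_suspension {a b : V} (hab : a ≠ b) (ha : {a} ∉ K) (hb : {b} ∉ K) :
    (K.suspension a b).IsTwin a b := by
  refine ⟨hab, fun τ hτ h => ?_, fun τ hτ h => ?_⟩
  all_goals
    rw [isSimplex_suspension ha hb] at hτ ⊢
    refine ⟨hτ.1.mono fun x hx => ?_, by simp [h, hab, hab.symm]⟩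
    simp only [Finset.mem_erase, Finset.mem_insert] at hx ⊢
    tauto

theorem IsWedgeOfPLSphere.exists_isTwin (h : K.IsWedgeOfPLSphere) :
    ∃ a b, K.IsTwin a b ∧ K.IsSimplex {a, b} := by
  obtain ⟨L, v, v', -, hv, hv', rfl⟩ := h
  exact ⟨v, v', isTwin_wedge hv hv'⟩

theorem IsSuspended.exists_isTwin (h : K.IsSuspended) : ∃ a b, K.IsTwin a b := by
  obtain ⟨L, a, b, -, hab, ha, hb, rfl⟩ := h
  exact ⟨a, b, isTwin_suspension hab ha hb⟩

/-- The sphere is the wedge of the link of `b` at `a`, with `b` as the new copy: by twinness every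
simplex avoiding both vertices lies in that link. -/
theorem IsTwin.isWedgeOfPLSphere (hK : K.IsPLSphere) {a b : V} (h : K.IsTwin a b)
    (hab : K.IsSimplex {a, b}) : K.IsWedgeOfPLSphere := by
  have hb := h.symm.singleton_mem
  have hlink : ∀ {s}, (K.link {b}).IsSimplex s ↔ K.IsSimplex (insert b s) ∧ b ∉ s :=
    isSimplex_link_singleton hb
  have ha' : {a} ∈ K.link {b} := IsSimplex.mem (hlink.mpr
    ⟨by rwa [Finset.pair_comm] at hab, by simpa using h.ne.symm⟩) (by simp)
  have hb' : {b} ∉ K.link {b} := fun h => (hlink.mp (Or.inr h)).2 (by simp)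
  refine ⟨K.link {b}, a, b, hK.link hb, ha', hb', ext_isSimplex fun s => ?_⟩
  rw [isSimplex_wedge ha' hb', hlink, hlink]
  constructor
  · intro hs
    have h1 : K.IsSimplex ((s.erase a).erase b) :=
      hs.mono ((Finset.erase_subset _ _).trans (Finset.erase_subset _ _))
    exact ⟨⟨h.right _ h1 (by simp), by simp⟩, fun _ hbs => ⟨by rwa [Finset.insert_erase hbs],
      by simp⟩⟩
  · rintro ⟨⟨h1, -⟩, h2⟩
    by_cases has : a ∈ s
    · by_cases hbs : b ∈ s
      · have := (h2 has hbs).1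
        rwa [Finset.insert_erase hbs] at this
      · rw [Finset.erase_eq_of_notMem (s := s.erase a) (by simp [hbs])] at h1
        have := h.left _ (h1.mono (Finset.subset_insert _ _)) (by simp [hbs])
        rwa [Finset.insert_erase has] at this
    · rw [Finset.erase_eq_of_notMem has] at h1
      refine h1.mono fun x hx => ?_
      rw [Finset.mem_insert, Finset.mem_erase]
      tauto

/-- By twinness every simplex avoiding both vertices lies in the link of `b`, and no simplex
contains both, so `a` and `b` are the apices of a suspension of that link. -/
theorem IsTwin.isSuspended (hK : K.IsPLSphere) {a b : V} (h : K.IsTwin a b)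
    (hab : ¬ K.IsSimplex {a, b}) : K.IsSuspended := by
  have hb := h.symm.singleton_mem
  have hlink : ∀ {s}, (K.link {b}).IsSimplex s ↔ K.IsSimplex (insert b s) ∧ b ∉ s :=
    isSimplex_link_singleton hb
  have ha' : {a} ∉ K.link {b} := fun h => hab (by
    rw [Finset.pair_comm]; exact (hlink.mp (Or.inr h)).1)
  have hb' : {b} ∉ K.link {b} := fun h => (hlink.mp (Or.inr h)).2 (by simp)
  refine ⟨K.link {b}, a, b, hK.link hb, h.ne, ha', hb', ext_isSimplex fun s => ?_⟩
  rw [isSimplex_suspension ha' hb', hlink]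
  constructor
  · intro hs
    have h1 : K.IsSimplex ((s.erase a).erase b) :=
      hs.mono ((Finset.erase_subset _ _).trans (Finset.erase_subset _ _))
    exact ⟨⟨h.right _ h1 (by simp), by simp⟩, fun hh => hab (hs.mono (by
      simp [Finset.insert_subset_iff, hh.1, hh.2]))⟩
  · rintro ⟨⟨h1, -⟩, h2⟩
    by_cases has : a ∈ s
    · have hbs : b ∉ s := fun hbs => h2 ⟨has, hbs⟩
      rw [Finset.erase_eq_of_notMem (s := s.erase a) (by simp [hbs])] at h1
      have := h.left _ (h1.mono (Finset.subset_insert _ _)) (by simp [hbs])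
      rwa [Finset.insert_erase has] at this
    · rw [Finset.erase_eq_of_notMem has] at h1
      refine h1.mono fun x hx => ?_
      rw [Finset.mem_insert, Finset.mem_erase]
      tauto

/-- An apex cannot have an adjacent twin: the twin is not the opposite apex, so twinness would allow
both apices in one simplex. Away from the apices, simplices of the suspension are simplices of `K`.
-/
theorem IsTwin.of_suspension {c d : V} (hcd : c ≠ d) (hc : {c} ∉ K) (hd : {d} ∉ K) {a b : V}
    (h : (K.suspension c d).IsTwin a b) (hab : (K.suspension c d).IsSimplex {a, b}) :
    K.IsTwin a b ∧ K.IsSimplex {a, b} := by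
  have hs := @isSimplex_suspension _ K _ c d hc hd
  have hsing : (K.suspension c d).IsSimplex {c} ∧ (K.suspension c d).IsSimplex {d} := by
    rw [hs, hs]
    refine ⟨⟨Or.inl (by ext; simp), by simp [hcd.symm]⟩, Or.inl (by ext; simp; tauto), by simp [hcd]⟩
  have key : ∀ {a b}, (K.suspension c d).IsTwin a b → (K.suspension c d).IsSimplex {a, b} →
      a ≠ c ∧ a ≠ d := by
    intro a b h hab
    constructor
    · rintro rfl
      have hbd : b ∉ ({d} : Finset V) := fun hbd => by
        rw [Finset.mem_singleton.mp hbd] at hab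
        exact (hs.mp hab).2 (by simp)
      exact (hs.mp (h.left {d} hsing.2 hbd)).2 (by simp)
    · rintro rfl
      have hbc : b ∉ ({c} : Finset V) := fun hbc => by
        rw [Finset.mem_singleton.mp hbc] at hab
        exact (hs.mp hab).2 (by simp)
      exact (hs.mp (h.left {c} hsing.1 hbc)).2 (by simp)
  obtain ⟨hac, had⟩ := key h hab
  obtain ⟨hbc, hbd⟩ := key h.symm (by rwa [Finset.pair_comm])
  have hiff : ∀ {τ}, c ∉ τ → d ∉ τ → ((K.suspension c d).IsSimplex τ ↔ K.IsSimplex τ) := by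
    intro τ h1 h2
    rw [hs, Finset.erase_eq_of_notMem h1, Finset.erase_eq_of_notMem h2]
    exact and_iff_left fun h => h1 h.1
  have hnot : ∀ {τ}, K.IsSimplex τ → c ∉ τ ∧ d ∉ τ := fun hτ =>
    ⟨fun h => hc (hτ.singleton_mem h), fun h => hd (hτ.singleton_mem h)⟩
  refine ⟨⟨h.ne, fun τ hτ hb => ?_, fun τ hτ ha => ?_⟩,
    (hiff (by simp [hac.symm, hbc.symm]) (by simp [had.symm, hbd.symm])).mp hab⟩
  · obtain ⟨h1, h2⟩ := hnot hτ
    exact (hiff (by simp [hac.symm, h1]) (by simp [had.symm, h2])).mp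
      (h.left τ ((hiff h1 h2).mpr hτ) hb)
  · obtain ⟨h1, h2⟩ := hnot hτ
    exact (hiff (by simp [hbc.symm, h1]) (by simp [hbd.symm, h2])).mp
      (h.right τ ((hiff h1 h2).mpr hτ) ha)

theorem IsTwin.of_map {f : V → W} (hf : Function.Injective f) {a b : W}
    (h : (K.map f).IsTwin a b) (hab : (K.map f).IsSimplex {a, b}) :
    ∃ u v, K.IsTwin u v ∧ K.IsSimplex {u, v} := by
  obtain ⟨u, -, rfl⟩ := singleton_mem_map.mp h.singleton_mem
  obtain ⟨v, -, rfl⟩ := singleton_mem_map.mp h.symm.singleton_mem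
  refine ⟨u, v, ⟨fun huv => h.ne (huv ▸ rfl), fun τ hτ hv => ?_, fun τ hτ hu => ?_⟩, ?_⟩
  · rw [← isSimplex_map_image hf, Finset.image_insert]
    exact h.left _ ((isSimplex_map_image hf).mpr hτ) (by simpa [hf.eq_iff] using hv)
  · rw [← isSimplex_map_image hf, Finset.image_insert]
    exact h.right _ ((isSimplex_map_image hf).mpr hτ) (by simpa [hf.eq_iff] using hu)
  · rw [← isSimplex_map_image hf]
    simpa [Finset.image_insert] using hab

end Twin

/-! ### Twins in the subdivision at an assembled face -/

/-- If `K` has no twins and `σ` picks one copy of every doubled vertex, of which there are at least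
two, then the stellar subdivision of `K(J)` at `σ` has no twins. -/
theorem not_isTwin_stellar_iteratedWedge {m : ℕ} (K : AbstractSimplicialComplex (Fin m))
    (hK : ∀ a b, ¬ K.toPreAbstractSimplicialComplex.IsTwin a b)
    {J : Fin m → ℕ} (hJpos : ∀ v, 1 ≤ J v) (hJ : ∀ v, J v ≤ 2) {s : Fin m → ℕ}
    (hs : ∀ v, s v < J v) (hcard : 1 < (assembledFace J s).card) {w : Fin m × ℕ}
    (hσ : assembledFace J s ∈ K.iteratedWedge J)
    (hw : {w} ∉ K.iteratedWedge J) (a b : Fin m × ℕ) :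
    ¬ ((K.iteratedWedge J).stellar (assembledFace J s) w).IsTwin a b := by
  set σ := assembledFace J s with hσdef
  set mark : Fin m → Fin m × ℕ := fun v => (v, s v) with hmark
  -- Since `J v ≤ 2`, this is the copy not chosen by `σ` if `v` is doubled, and coincides with `mark
  -- v` if `v` has a single copy.
  set bar : Fin m → Fin m × ℕ := fun v => (v, J v - 1 - s v) with hbar
  have hst := @isSimplex_stellar _ _ _ _ _ hσ hw
  have hX := @isSimplex_iteratedWedge _ _ _ K.toPreAbstractSimplicialComplex J hJpos
  have hmark_valid : ∀ v, (mark v).2 < J (mark v).1 := fun v => hs v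
  have hbar_valid : ∀ v, (bar v).2 < J (bar v).1 := fun v => by
    have := hJpos v
    simp only [hbar]
    omega
  have hw_invalid : ∀ x : Fin m × ℕ, x.2 < J x.1 → x ≠ w := by
    rintro x hx rfl
    exact hw ((singleton_mem_iteratedWedge K hJpos).mpr hx)
  have hcopy : ∀ v i, i < J v → (v, i) = mark v ∨ (v, i) = bar v := by
    intro v i hi
    have h1 := hJ v
    have h2 := hs v
    simp only [hmark, hbar, Prod.mk.injEq, true_and]
    omega
  have hmb : ∀ u v, mark u = bar v → u = v ∧ J u = 1 := by
    intro u v h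
    obtain ⟨h1, h2⟩ := Prod.mk.inj h
    subst h1
    have h3 := hJ u
    have h4 := hs u
    exact ⟨rfl, by omega⟩
  have hbar_eq : ∀ v, J v = 1 → mark v = bar v := by
    intro v h
    have := hs v
    simp only [hmark, hbar, Prod.mk.injEq, true_and]
    omega
  have hmark_inj : ∀ u v, mark u = mark v → u = v := fun u v h => (Prod.mk.inj h).1
  have hbar_inj : ∀ u v, bar u = bar v → u = v := fun u v h => (Prod.mk.inj h).1
  have hmem : ∀ x, x ∈ σ ↔ ∃ v, J v ≠ 1 ∧ mark v = x := by
    intro x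
    simp [hσdef, assembledFace, hmark]
  have hmarkσ : ∀ v, J v ≠ 1 → mark v ∈ σ := fun v h => (hmem _).mpr ⟨v, h, rfl⟩
  have hbarσ : ∀ v, bar v ∉ σ := by
    intro v h
    obtain ⟨u, hu, huv⟩ := (hmem _).mp h
    exact hu (hmb u v huv).2
  have hwσ : w ∉ σ := fun h => hw (IsSimplex.singleton_mem (Or.inr hσ) h)
  have hbarw : ∀ v, bar v ≠ w := fun v => hw_invalid _ (hbar_valid v)
  have hσ_valid : ∀ x ∈ σ, x.2 < J x.1 := fun x hx => hσ.2.1 x hx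
  obtain ⟨x₁, hx₁, x₂, hx₂, hne⟩ := Finset.one_lt_card.mp hcard
  obtain ⟨v₁, hv₁, rfl⟩ := (hmem _).mp hx₁
  obtain ⟨v₂, hv₂, rfl⟩ := (hmem _).mp hx₂
  have hv₁₂ : v₁ ≠ v₂ := fun h => hne (h ▸ rfl)
  have hto : ∀ {T : Finset (Fin m × ℕ)} {t : Finset (Fin m)}, K.IsSimplex t →
      (∀ x ∈ T, x.2 < J x.1) → (∀ v, mark v ∈ T → bar v ∈ T → v ∈ t) →
      (K.iteratedWedge J).IsSimplex T := by
    intro T t ht h1 h2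
    refine hX.mpr ⟨h1, ht.mono fun v hv => ?_⟩
    have := mem_fullVertices.mp hv
    exact h2 v (this _ (hmark_valid v)) (this _ (hbar_valid v))
  have hfrom : ∀ {T : Finset (Fin m × ℕ)} {t : Finset (Fin m)},
      (K.iteratedWedge J).IsSimplex T → (∀ v ∈ t, mark v ∈ T ∧ bar v ∈ T) → K.IsSimplex t := by
    intro T t hT h
    refine (hX.mp hT).2.mono fun v hv => mem_fullVertices.mpr fun i hi => ?_
    rcases hcopy v i hi with h' | h' <;> rw [h']
    exacts [(h v hv).1, (h v hv).2]
  have hvalid_ne : ∀ {T : Finset (Fin m × ℕ)}, (∀ x ∈ T, x.2 < J x.1) → w ∉ T :=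
    fun hT h => hw_invalid w (hT w h) rfl
  have hmark_or : ∀ v, mark v ∈ σ ∨ mark v = bar v := fun v => by
    by_cases h : J v = 1
    · exact Or.inr (hbar_eq v h)
    · exact Or.inl (hmarkσ v h)
  -- After the subdivision `σ` is a minimal non-face: a twin outside `σ` would allow the missing
  -- vertex to be added to `σ.erase a`.
  have houter : ∀ {a b}, ((K.iteratedWedge J).stellar σ w).IsTwin a b → a ∈ σ → b ∈ σ := by
    intro a b h ha
    by_contra hb
    have h1 : ((K.iteratedWedge J).stellar σ w).IsSimplex (σ.erase a) := by
      refine hst.mpr ⟨IsSimplex.mono (Or.inr hσ) ((Finset.erase_subset _ _).trans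
        (Finset.erase_subset _ _)), fun h => ?_, fun h => absurd (Finset.mem_of_mem_erase h) hwσ⟩
      exact Finset.notMem_erase a σ (h ha)
    have h2 := h.left _ h1 fun h => hb (Finset.mem_of_mem_erase h)
    rw [Finset.insert_erase ha] at h2
    exact (hst.mp h2).2.1 subset_rfl
  have hmarks : ∀ {u v}, J u ≠ 1 → J v ≠ 1 →
      ((K.iteratedWedge J).stellar σ w).IsTwin (mark u) (mark v) →
      ∀ τ, K.IsSimplex τ → v ∉ τ → K.IsSimplex (insert u τ) := by
    intro u v hu hv h τ hτ hvτ
    have huv : u ≠ v := fun huv => h.ne (huv ▸ rfl)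
    -- Exactly the vertices of `τ` have both copies in `T`, and `mark v` is absent, so `T` is a
    -- simplex. Adding `mark u` completes the pair of copies of `u`.
    set T := τ.image mark ∪ (insert u τ).image bar with hT
    have hTm : ∀ x, mark x ∈ T → x ∈ τ ∨ (x = u ∧ J x = 1) := by
      intro x hx
      rcases Finset.mem_union.mp hx with hx | hx
      · obtain ⟨y, hy, hyx⟩ := Finset.mem_image.mp hx
        exact Or.inl (hmark_inj _ _ hyx ▸ hy)
      · obtain ⟨y, hy, hyx⟩ := Finset.mem_image.mp hx
        obtain ⟨rfl, h1⟩ := hmb _ _ hyx.symm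
        rcases Finset.mem_insert.mp hy with hy | hy
        exacts [Or.inr ⟨hy, h1⟩, Or.inl hy]
    have hTm' : ∀ x, mark x ∈ T → x ∈ τ := fun x hx =>
      (hTm x hx).resolve_right fun ⟨h1, h2⟩ => hu (h1 ▸ h2)
    have hTv : ∀ x ∈ T, x.2 < J x.1 := by
      intro x hx
      rcases Finset.mem_union.mp hx with hx | hx <;> obtain ⟨y, -, rfl⟩ := Finset.mem_image.mp hx
      exacts [hmark_valid y, hbar_valid y]
    have hwT := hvalid_ne hTv
    have hvT : mark v ∉ T := fun h => hvτ (hTm' v h)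
    have h1 : ((K.iteratedWedge J).stellar σ w).IsSimplex T := by
      refine hst.mpr ⟨?_, fun h => hvT (h (hmarkσ v hv)), fun h => absurd h hwT⟩
      rw [Finset.erase_eq_of_notMem hwT]
      exact hto hτ hTv fun x hx _ => hTm' x hx
    have h2 := (hst.mp (h.left T h1 hvT)).1
    rw [Finset.erase_eq_of_notMem (by simp [hwT, (hw_invalid _ (hmark_valid u)).symm])] at h2
    refine hfrom h2 fun x hx => ⟨?_, ?_⟩
    · rcases Finset.mem_insert.mp hx with rfl | hx
      · exact Finset.mem_insert_self _ _
      · exact Finset.mem_insert_of_mem (Finset.mem_union_left _ (Finset.mem_image_of_mem _ hx))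
    · exact Finset.mem_insert_of_mem (Finset.mem_union_right _ (Finset.mem_image_of_mem _ hx))
  have hbarT : ∀ {τ : Finset (Fin m)} {x}, bar x ∈ τ.image bar → x ∈ τ := by
    intro τ x hx
    obtain ⟨y, hy, hyx⟩ := Finset.mem_image.mp hx
    exact hbar_inj _ _ hyx ▸ hy
  have hwbar : ∀ τ : Finset (Fin m), w ∉ τ.image bar := by
    intro τ h
    obtain ⟨y, -, hy⟩ := Finset.mem_image.mp h
    exact hbarw y hy
  have hmarkbar : ∀ {τ : Finset (Fin m)} {x}, mark x ∈ τ.image bar → x ∈ τ ∧ J x = 1 := by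
    intro τ x hx
    obtain ⟨y, hy, hyx⟩ := Finset.mem_image.mp hx
    obtain ⟨rfl, h1⟩ := hmb _ _ hyx.symm
    exact ⟨hy, h1⟩
  have hbars : ∀ {u v}, ((K.iteratedWedge J).stellar σ w).IsTwin (bar u) (bar v) →
      ∀ τ, K.IsSimplex τ → v ∉ τ → K.IsSimplex (insert u τ) := by
    intro u v h τ hτ hvτ
    have hTv : ∀ x ∈ τ.image bar ∪ σ, x.2 < J x.1 := by
      intro x hx
      rcases Finset.mem_union.mp hx with hx | hx
      · obtain ⟨y, -, rfl⟩ := Finset.mem_image.mp hx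
        exact hbar_valid y
      · exact hσ_valid x hx
    have h0 : (K.iteratedWedge J).IsSimplex (τ.image bar ∪ σ) :=
      hto hτ hTv fun x _ hx => hbarT ((Finset.mem_union.mp hx).resolve_right (hbarσ x))
    -- In the presence of `w` all of `σ` may be added in `K(J)`, so the unchosen copies alone span a
    -- simplex exactly when their vertices do in `K`.
    have h1 : ((K.iteratedWedge J).stellar σ w).IsSimplex (insert w (τ.image bar)) := by
      refine hst.mpr ?_
      rw [Finset.erase_insert (hwbar τ)]
      refine ⟨h0.mono Finset.subset_union_left, fun h => ?_, fun _ => h0⟩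
      rcases Finset.mem_insert.mp (h hx₁) with h' | h'
      · exact hw_invalid _ (hmark_valid v₁) h'
      · exact hv₁ (hmarkbar h').2
    have hvT : bar v ∉ insert w (τ.image bar) := fun h => by
      rcases Finset.mem_insert.mp h with h | h
      exacts [hbarw v h, hvτ (hbarT h)]
    have h2 := (hst.mp (h.left _ h1 hvT)).2.2 (by simp)
    have h3 : ∀ x ∈ insert u τ, bar x ∈ (insert (bar u) (insert w (τ.image bar))).erase w ∪ σ := by
      intro x hx
      refine Finset.mem_union_left _ (Finset.mem_erase.mpr ⟨hbarw x, ?_⟩)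
      rcases Finset.mem_insert.mp hx with rfl | hx
      · exact Finset.mem_insert_self _ _
      · exact Finset.mem_insert_of_mem (Finset.mem_insert_of_mem (Finset.mem_image_of_mem _ hx))
    refine hfrom h2 fun x hx => ⟨?_, h3 x hx⟩
    rcases hmark_or x with h | h
    · exact Finset.mem_union_right _ h
    · rw [h]; exact h3 x hx
  have hnew : ∀ {u}, ((K.iteratedWedge J).stellar σ w).IsTwin w (bar u) →
      ∀ {y z}, J y ≠ 1 → J z ≠ 1 → y ≠ z → ∀ τ, K.IsSimplex τ → z ∉ τ →
        K.IsSimplex (insert y τ) := by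
    intro u h y z hy hz hyz
    -- The unchosen copies of `insert y τ` form a simplex because `mark y` is missing. The twin of
    -- `bar u` allows `w` to be added, and hence all of `σ`, which fills in the missing copies.
    have hoff : ∀ τ, K.IsSimplex τ → u ∉ insert y τ → K.IsSimplex (insert y τ) := by
      intro τ hτ hu
      have hTv : ∀ x ∈ (insert y τ).image bar, x.2 < J x.1 := by
        intro x hx
        obtain ⟨y, -, rfl⟩ := Finset.mem_image.mp hx
        exact hbar_valid y
      have h1 : ((K.iteratedWedge J).stellar σ w).IsSimplex ((insert y τ).image bar) := by
        refine hst.mpr ⟨?_, fun h => hy (hmarkbar (h (hmarkσ y hy))).2,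
          fun h => absurd h (hwbar _)⟩
        rw [Finset.erase_eq_of_notMem (hwbar _)]
        refine hto hτ hTv fun x hx _ => ?_
        obtain ⟨h1, h2⟩ := hmarkbar hx
        exact (Finset.mem_insert.mp h1).resolve_left fun h => hy (h ▸ h2)
      have h2 := (hst.mp (h.left _ h1 fun h => hu (hbarT h))).2.2 (by simp)
      rw [Finset.erase_insert (hwbar _)] at h2
      have h3 : ∀ x ∈ insert y τ, bar x ∈ (insert y τ).image bar ∪ σ := fun x hx =>
        Finset.mem_union_left _ (Finset.mem_image_of_mem _ hx)
      refine hfrom h2 fun x hx => ⟨?_, h3 x hx⟩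
      rcases hmark_or x with h | h
      · exact Finset.mem_union_right _ h
      · rw [h]; exact h3 x hx
    intro τ hτ hzτ
    by_cases hu : u ∈ insert y τ
    · have herase : K.IsSimplex ((insert y τ).erase u) := by
        by_cases huy : u = y
        · subst huy
          exact hτ.mono fun x hx => by
            rw [Finset.mem_erase, Finset.mem_insert] at hx
            tauto
        · rw [Finset.erase_insert_of_ne (Ne.symm huy)]
          exact hoff _ (hτ.mono (Finset.erase_subset _ _)) (by simp [huy])
      -- All copies of `insert y τ` except `bar u`: a simplex by `herase`, not containing `σ`
      -- because `mark z` is absent. As `w` is absent too, twinness restores `bar u`.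
      set T := ((insert y τ).image mark ∪ (insert y τ).image bar).erase (bar u) with hT
      have hTv : ∀ x ∈ T, x.2 < J x.1 := by
        intro x hx
        rcases Finset.mem_union.mp (Finset.mem_of_mem_erase hx) with hx | hx <;>
          obtain ⟨y, -, rfl⟩ := Finset.mem_image.mp hx
        exacts [hmark_valid y, hbar_valid y]
      have hwT := hvalid_ne hTv
      have hmem_of : ∀ x : Fin m, (mark x ∈ (insert y τ).image mark ∪ (insert y τ).image bar ∨
          bar x ∈ (insert y τ).image mark ∪ (insert y τ).image bar) → x ∈ insert y τ := by
        rintro x (hx | hx) <;> rcases Finset.mem_union.mp hx with hx | hx <;>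
          obtain ⟨y, hy, hyx⟩ := Finset.mem_image.mp hx <;>
          obtain rfl : y = x := (Prod.mk.inj hyx).1 <;> exact hy
      have h1 : ((K.iteratedWedge J).stellar σ w).IsSimplex T := by
        refine hst.mpr ⟨?_, fun h => ?_, fun h => absurd h hwT⟩
        · rw [Finset.erase_eq_of_notMem hwT]
          refine hto herase hTv fun x _ hx => ?_
          obtain ⟨h1, h2⟩ := Finset.mem_erase.mp hx
          exact Finset.mem_erase.mpr ⟨fun h => h1 (h ▸ rfl), hmem_of x (Or.inr h2)⟩
        · have := hmem_of z (Or.inl (Finset.mem_of_mem_erase (h (hmarkσ z hz))))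
          rcases Finset.mem_insert.mp this with h | h
          exacts [hyz h.symm, hzτ h]
      have h2 := (hst.mp (h.right T h1 hwT)).1
      have h3 : insert (bar u) T = (insert y τ).image mark ∪ (insert y τ).image bar :=
        Finset.insert_erase (Finset.mem_union_right _ (Finset.mem_image_of_mem _ hu))
      rw [Finset.erase_eq_of_notMem (by simp [hwT, (hbarw u).symm]), h3] at h2
      exact hfrom h2 fun x hx => ⟨Finset.mem_union_left _ (Finset.mem_image_of_mem _ hx),
        Finset.mem_union_right _ (Finset.mem_image_of_mem _ hx)⟩
    · exact hoff τ hτ hu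
  -- Here the second doubled vertex is needed: `v₁` and `v₂` would be twins of `K`.
  have hnew' : ∀ u, ¬ ((K.iteratedWedge J).stellar σ w).IsTwin w (bar u) := fun u h =>
    hK v₁ v₂ ⟨hv₁₂, hnew h hv₁ hv₂ hv₁₂, hnew h hv₂ hv₁ hv₁₂.symm⟩
  have hclass : ∀ {a b}, ((K.iteratedWedge J).stellar σ w).IsTwin a b →
      a = w ∨ (∃ v, J v ≠ 1 ∧ mark v = a) ∨ ∃ v, bar v = a := by
    intro a b h
    by_cases haw : a = w
    · exact Or.inl haw
    right
    have := (hX.mp (hst.mp (Or.inr h.singleton_mem)).1).1 a (by simp [haw])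
    obtain ⟨v, i⟩ := a
    rcases hcopy v i this with h' | h'
    · by_cases hv : J v = 1
      · exact Or.inr ⟨v, by rw [h', hbar_eq v hv]⟩
      · exact Or.inl ⟨v, hv, h'.symm⟩
    · exact Or.inr ⟨v, h'.symm⟩
  intro h
  rcases hclass h with rfl | ⟨u, hu, rfl⟩ | ⟨u, rfl⟩
  · rcases hclass h.symm with hb | ⟨v, hv, rfl⟩ | ⟨v, rfl⟩
    · exact h.ne hb.symm
    · exact hwσ (houter h.symm (hmarkσ v hv))
    · exact hnew' v h
  · obtain ⟨v, hv, rfl⟩ := (hmem b).mp (houter h (hmarkσ u hu))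
    exact hK u v ⟨fun huv => h.ne (huv ▸ rfl), hmarks hu hv h, hmarks hv hu h.symm⟩
  · rcases hclass h.symm with rfl | ⟨v, hv, rfl⟩ | ⟨v, rfl⟩
    · exact hnew' u h.symm
    · exact hbarσ u (houter h.symm (hmarkσ v hv))
    · exact hK u v ⟨fun huv => h.ne (huv ▸ rfl), hbars h, hbars h.symm⟩

/-- The face omits one copy of each doubled vertex and the only copy of every other one, so no
vertex is full. -/
theorem assembledFace_mem {m : ℕ} (K : PreAbstractSimplicialComplex (Fin m))
    {J : Fin m → ℕ} (hJpos : ∀ v, 1 ≤ J v) {s : Fin m → ℕ} (hs : ∀ v, s v < J v)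
    (hne : (assembledFace J s).Nonempty) : assembledFace J s ∈ K.iteratedWedge J := by
  have hmem : ∀ v i, (v, i) ∈ assembledFace J s ↔ J v ≠ 1 ∧ i = s v := by
    intro v i
    simp [assembledFace, eq_comm]
  refine IsSimplex.mem ((isSimplex_iteratedWedge hJpos).mpr ⟨?_, Or.inl ?_⟩) hne
  · rintro ⟨v, i⟩ hx
    rw [((hmem v i).mp hx).2]
    exact hs v
  · refine Finset.eq_empty_of_forall_notMem fun v hv => ?_
    have h1 := mem_fullVertices.mp hv
    have h2 := hJpos v
    have h3 := (hmem _ _).mp (h1 0 h2)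
    have h4 := (hmem _ _).mp (h1 1 (by omega))
    omega

/-! ### The two parts of the theorem -/

/-- If exactly one vertex is doubled, then the subdivision of `K(J)` at the edge of its two copies is
a suspended seed. -/
theorem isSeed_isSuspended_stellar_edge {m : ℕ} (K : AbstractSimplicialComplex (Fin m))
    (hK : K.toPreAbstractSimplicialComplex.IsSeed) {J : Fin m → ℕ} {v : Fin m}
    (hJ : J = Function.update (fun _ => 1) v 2) {w : Fin m × ℕ}
    (hw : {w} ∉ K.iteratedWedge J) :
    ((K.iteratedWedge J).stellar {(v, 0), (v, 1)} w).IsSeed ∧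
      ((K.iteratedWedge J).stellar {(v, 0), (v, 1)} w).IsSuspended := by
  have hinj : Function.Injective (fun u : Fin m => (u, 0)) := fun a b h => (Prod.ext_iff.mp h).1
  have hJpos : ∀ u, 1 ≤ J u := by
    intro u
    by_cases hu : u = v
    · subst hu; simp [hJ]
    · simp [hJ, hu]
  have hXw : K.iteratedWedge J = (K.map fun u => (u, 0)).wedge (v, 0) (v, 1) := by
    have := iteratedWedge_succ K (fun _ => 1) (fun _ => le_rfl) v
    rwa [iteratedWedge_one, ← hJ] at this
  have hvert : ∀ {x : Fin m × ℕ}, {x} ∈ K.map (fun u => (u, 0)) ↔ x.2 = 0 := by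
    intro x
    rw [singleton_mem_map]
    constructor
    · rintro ⟨u, -, rfl⟩; rfl
    · intro hx
      exact ⟨x.1, K.singleton_mem x.1, Prod.ext rfl hx.symm⟩
  rw [singleton_mem_iteratedWedge K hJpos] at hw
  have hJv : J v = 2 := by simp [hJ]
  have hw0 : w.2 ≠ 0 := fun h => hw (by rw [h]; exact hJpos _)
  have hwv : w ≠ (v, 1) := by
    rintro rfl
    exact hw (by simp [hJv])
  obtain ⟨-, -, hc, hd, heq⟩ := stellar_wedge (K := K.map fun u => (u, 0)) (v := (v, 0))
    (v' := (v, 1)) (w := w) (hvert.mpr rfl) (by simp [hvert]) (by simpa [hvert] using hw0) hwv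
  have hsph := (hK.1.map hinj).map (Equiv.injective (Equiv.swap (v, 0) w))
  have hne : ((v, 0) : Fin m × ℕ) ≠ (v, 1) := by simp
  rw [hXw, heq]
  refine ⟨⟨hsph.suspension hne hc hd, fun hwed => ?_⟩, _, _, _, hsph, hne, hc, hd, rfl⟩
  -- Adjacent twins are carried down through the suspension and two renamings to `K`, where they
  -- would contradict the seed property.
  obtain ⟨a, b, hab, hs⟩ := hwed.exists_isTwin
  obtain ⟨hab, hs⟩ := hab.of_suspension hne hc hd hs
  obtain ⟨a, b, hab, hs⟩ := hab.of_map (Equiv.injective _) hs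
  obtain ⟨a, b, hab, hs⟩ := hab.of_map hinj hs
  exact hK.2 (hab.isWedgeOfPLSphere hK.1 hs)

end PreAbstractSimplicialComplex

theorem theorem3p1 (m : ℕ) (K : AbstractSimplicialComplex (Fin m))
    (hK : K.toPreAbstractSimplicialComplex.IsSeed)
    (J : Fin m → ℕ) (hJpos : ∀ v, 1 ≤ J v) (hJ : ∀ v, J v ≤ 2)
    (s : Fin m → ℕ) (hs : ∀ v, s v < J v)
    (σ : Finset (Fin m × ℕ)) (hσ : σ = PreAbstractSimplicialComplex.assembledFace J s)
    (w : Fin m × ℕ) (hw : {w} ∉ K.iteratedWedge J) :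
    (∀ v : Fin m, σ = {(v, s v)} →
      ((K.iteratedWedge J).stellar {(v, 0), (v, 1)} w).IsSeed ∧
      ((K.iteratedWedge J).stellar {(v, 0), (v, 1)} w).IsSuspended) ∧
    (1 < σ.card → ¬ K.toPreAbstractSimplicialComplex.IsSuspended →
      ((K.iteratedWedge J).stellar σ w).IsSeed ∧
      ¬ ((K.iteratedWedge J).stellar σ w).IsSuspended) := by
  subst hσ
  constructor
  · intro v hv
    -- A one-element assembled face means that `v` is the only doubled vertex.
    have hmem : ∀ u, J u ≠ 1 ↔ u = v := by
      intro u
      have h1 : (u, s u) ∈ PreAbstractSimplicialComplex.assembledFace J s ↔ J u ≠ 1 := by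
        simp [PreAbstractSimplicialComplex.assembledFace]
      rw [← h1, hv, Finset.mem_singleton, Prod.mk.injEq]
      exact ⟨fun h => h.1, fun h => ⟨h, by rw [h]⟩⟩
    refine PreAbstractSimplicialComplex.isSeed_isSuspended_stellar_edge K hK (funext fun u => ?_) hw
    by_cases hu : u = v
    · subst hu
      have h1 := (hmem u).mpr rfl
      have h2 := hJ u
      have h3 := hJpos u
      rw [Function.update_self]
      omega
    · rw [Function.update_of_ne hu]
      by_contra h
      exact hu ((hmem u).mp h)
  · intro hcard hnsusp
    have hface := PreAbstractSimplicialComplex.assembledFace_mem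
      K.toPreAbstractSimplicialComplex hJpos hs (Finset.card_pos.mp (by omega))
    -- Adjacent twins would make `K` a wedge, and non-adjacent ones a suspension.
    have hnt : ∀ a b, ¬ K.toPreAbstractSimplicialComplex.IsTwin a b := by
      intro a b hab
      by_cases h : K.IsSimplex {a, b}
      · exact hK.2 (hab.isWedgeOfPLSphere hK.1 h)
      · exact hnsusp (hab.isSuspended hK.1 h)
    have hnt' := PreAbstractSimplicialComplex.not_isTwin_stellar_iteratedWedge K hnt hJpos hJ hs
      hcard hface hw
    have hsph := (PreAbstractSimplicialComplex.isPLSphere_iteratedWedge K hK.1 _ J hJpos rfl).stellar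
      hface hw
    refine ⟨⟨hsph, fun h => ?_⟩, fun h => ?_⟩
    · obtain ⟨a, b, hab, -⟩ := h.exists_isTwin
      exact hnt' a b hab
    · obtain ⟨a, b, hab⟩ := h.exists_isTwin
      exact hnt' a b hab
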